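/- For $s>0$ let $$W_s(x)=\prod_{n\ge 1}\Bigl(1+\frac{x}{n^s}\Bigr)\exp\Bigl(\sum_{j=1}^{\lfloor 1/s\rfloor}\frac{(-1)^j x^j}{j\,n^{sj}}\Bigr),\qquad x\in(0,\infty),$$ and for $s>1$ let $F_s(x)=\prod_{n\ge 1}(1+s^{-n}x)$ for $x\in\mathbb R$. For a family of partial functions $f_i$ from $\mathbb R$ to $\mathbb R$, let $(\overline{\mathbb R},(f_i)_i)$ denote the expansion of the real field with constants $\overline{\mathbb R}=(\mathbb R,+,\cdot,(r)_{r\in\mathbb R})$ by the graphs of the $f_i$. Such a structure \emph{defines} a set $S\subseteq\mathbb R$ if $S$ is the set of realizations of a first-order formula in its language. Let $\alpha>1$ and let $\beta>0$ be such that $1/\beta\in\mathbb N$ or $\beta\notin\mathbb Q$. Then $$\bigl(\overline{\mathbb R},\,(xF_\alpha'/F_\alpha)',\,(xW_\beta'/W_\beta)'\bigr)$$ defines $\mathbb Z$. Here $(xW_\beta'/W_\beta)'$ is a function on $(0,\infty)$, and the assertion holds both when $(xF_\alpha'/F_\alpha)'$ is taken on its whole natural domain $\{x\in\mathbb R: F_\alpha(x)\neq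 0\}$ and when it is restricted to $(0,\infty)$. -/

import Mathlib

open FirstOrder

/-- Function symbols of the real field with constants: `+`, `·`, and a name for each real. -/
inductive RbarFunc : ℕ → Type
  | const (r : ℝ) : RbarFunc 0
  | add : RbarFunc 2
  | mul : RbarFunc 2

/-- One binary relation symbol for (the graph of) each member of a family indexed by `ι`. -/
inductive GraphRel (ι : Type) : ℕ → Type
  | graph (i : ι) : GraphRel ι 2

/-- The language of the expansion `(ℝ, +, ·, (r)_{r ∈ ℝ}, (f i)_{i ∈ ι})` of the real field with
constants by a family `f` of partial functions from `ℝ` to `ℝ`, each given by its graph.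
(The symbols depend only on `ι`; `f` is recorded so as to determine their interpretation.) -/
def RbarLang {ι : Type} (_f : ι → (ℝ →. ℝ)) : Language :=
  ⟨RbarFunc, GraphRel ι⟩

/-- The structure `(ℝ, +, ·, (r)_{r ∈ ℝ}, (f i)_{i ∈ ι})`. -/
instance RbarLang.structureReal {ι : Type} (f : ι → (ℝ →. ℝ)) : (RbarLang f).Structure ℝ where
  funMap {n} (s : RbarFunc n) :=
    match n, s with
    | _, .const r => fun _ => r
    | _, .add => fun v => v 0 + v 1
    | _, .mul => fun v => v 0 * v 1
  RelMap {n} (s : GraphRel ι n) :=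
    match n, s with
    | _, .graph i => fun v => v 1 ∈ f i (v 0)

/-- The structure `(ℝ, +, ·, (r)_{r ∈ ℝ}, (f i)_{i ∈ ι})` defines the set `S ⊆ ℝ`: membership in
`S` is expressed by a first-order formula of its language, which has a constant for each real. -/
def RbarDefines {ι : Type} (f : ι → (ℝ →. ℝ)) (S : Set ℝ) : Prop :=
  (∅ : Set ℝ).Definable₁ (RbarLang f) S

/-- The canonical Weierstrass product
`W_s(x) = ∏_{n > 0} (1 + x / n ^ s) * exp (∑_{j = 1}^{⌊1/s⌋} (-1)^j x^j / (j n^(s j)))`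
for the sequence `(-n ^ s)_{n > 0}`, at a real argument (where it takes real values). -/
noncomputable def weierstrassW (s x : ℝ) : ℝ :=
  ∏' n : ℕ, (1 + x / ((n : ℝ) + 1) ^ s) *
    Real.exp (∑ j ∈ Finset.Icc 1 ⌊1 / s⌋₊,
      (-1) ^ j * x ^ j / ((j : ℝ) * ((n : ℝ) + 1) ^ (s * (j : ℝ))))

/-- The product `F_s(x) = ∏_{n > 0} (1 + s ^ (-n) x)`, at a real argument. -/
noncomputable def eulerF (s x : ℝ) : ℝ :=
  ∏' n : ℕ, (1 + (s ^ (n + 1))⁻¹ * x)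

/-- The function `(x G' / G)'`. -/
noncomputable def derivXLogDeriv (G : ℝ → ℝ) : ℝ → ℝ :=
  deriv fun x => x * deriv G x / G x

/-!
Write `F` for `eulerF α`, `W` for `weierstrassW β`, `r = 1 / β` and `k = ⌊r⌋`. For a canonical
product `G` of genus `k` with zeros `-1 / a n`, the function `x (x G' / G)'` is, up to sign, the sum
of the values at `a n * x` of one elementary function (`mul_derivXLogDeriv_eq`).

For `F` this function is `∑ w / (1 + w) ^ 2` over `w = x / α ^ n`, `n ≥ 1`. Its difference from the
sum over all `n ∈ ℤ`, which is exactly periodic under `x ↦ α x`, tends to `0` as `x → ∞`. Hence the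
group of all periods of the two-sided sum is definable as the group of asymptotic periods of the
one-sided sum. The two-sided sum is not constant, because its analytic continuation has a pole at
`-1`; so the group of periods is `γ ^ ℤ` for some `γ > 1` (`exists_generator_periods`).

For `W` the sum is a Riemann sum in the variable `n * x ^ (-r)`.
* If `r` is irrational, the sum is asymptotic to a constant multiple of `x ^ r`, so that
  `y ↦ y ^ r` is definable as a limit of quotients (`tendsto_eulerSum_div`).
* If `r = m` is an integer, the sum divided by `x ^ m` grows logarithmically, and its asymptotic
  increments define a nonzero multiple of the logarithm on `γ ^ ℤ`
  (`exists_tendsto_eulerSum_sub`).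

In the second case the image of `γ ^ ℤ` under the logarithm is a multiple of `ℤ`. In the first, let
`φ j` be the representative of `γ ^ (j r)` in `[1, γ)`. The `φ j` are dense, and nested intervals
give a real `c` such that the numbers `1 / (γ ^ j (c - φ j))` exceeding `1` form, up to finitely
many, a sequence asymptotic to `n + 2` (`exists_coding_real`). This set of numbers is definable with
the parameter `c`, and the integers are the limits of differences of its ever larger members
(`mem_range_intCast_iff_of_sequence`).
-/

/-! ### Definable predicates and functions -/

section Definability

variable {ι : Type} {f : ι → (ℝ →. ℝ)}

/-- A predicate on assignments `ℕ → ℝ` of the variables is definable if it is expressed by a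
formula. Quantifiers are handled in de Bruijn style: variable `0` is the innermost one. -/
def DefinablePred (f : ι → (ℝ →. ℝ)) (P : (ℕ → ℝ) → Prop) : Prop :=
  ∃ φ : (RbarLang f).Formula ℕ, ∀ v : ℕ → ℝ, φ.Realize v ↔ P v

/-- A function of the assignment is definable if its graph is; variable `0` is the value. -/
def DefinableFun (f : ι → (ℝ →. ℝ)) (t : (ℕ → ℝ) → ℝ) : Prop :=
  DefinablePred f fun v => v 0 = t fun i => v (i + 1)

/-- The renaming of variables that sends `0` to `a` and `i + 1` to `σ i`. -/
def consIdx (a : ℕ) (σ : ℕ → ℕ) (i : ℕ) : ℕ := Nat.casesOn i a σ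

namespace DefinablePred

lemma congr {P Q : (ℕ → ℝ) → Prop} (h : DefinablePred f P) (hPQ : ∀ v, Q v ↔ P v) :
    DefinablePred f Q := by
  obtain ⟨φ, hφ⟩ := h
  exact ⟨φ, fun v => (hφ v).trans (hPQ v).symm⟩

lemma not {P : (ℕ → ℝ) → Prop} (h : DefinablePred f P) : DefinablePred f fun v => ¬ P v := by
  obtain ⟨φ, hφ⟩ := h
  exact ⟨φ.not, fun v => by rw [Language.Formula.realize_not, hφ]⟩

lemma and {P Q : (ℕ → ℝ) → Prop} (hP : DefinablePred f P) (hQ : DefinablePred f Q) :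
    DefinablePred f fun v => P v ∧ Q v := by
  obtain ⟨φ, hφ⟩ := hP
  obtain ⟨ψ, hψ⟩ := hQ
  exact ⟨φ ⊓ ψ, fun v => by rw [Language.Formula.realize_inf, hφ, hψ]⟩

lemma or {P Q : (ℕ → ℝ) → Prop} (hP : DefinablePred f P) (hQ : DefinablePred f Q) :
    DefinablePred f fun v => P v ∨ Q v :=
  (hP.not.and hQ.not).not.congr fun v => by tauto

lemma imp {P Q : (ℕ → ℝ) → Prop} (hP : DefinablePred f P) (hQ : DefinablePred f Q) :
    DefinablePred f fun v => P v → Q v :=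
  (hP.and hQ.not).not.congr fun v => by tauto

lemma reindex {P : (ℕ → ℝ) → Prop} (hP : DefinablePred f P) (σ : ℕ → ℕ) :
    DefinablePred f fun v => P fun i => v (σ i) := by
  obtain ⟨φ, hφ⟩ := hP
  exact ⟨φ.relabel σ, fun v => by rw [Language.Formula.realize_relabel, hφ]; rfl⟩

lemma ex {P : (ℕ → ℝ) → ℝ → Prop} (hP : DefinablePred f fun v => P (fun i => v (i + 1)) (v 0)) :
    DefinablePred f fun v => ∃ x, P v x := by
  obtain ⟨φ, hφ⟩ := hP
  let g : ℕ → ℕ ⊕ Fin 1 := fun n => Nat.casesOn n (Sum.inr 0) Sum.inl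
  refine ⟨(φ.relabel g).iExs (Fin 1), fun v => ?_⟩
  rw [Language.Formula.realize_iExs]
  constructor
  · rintro ⟨i, hi⟩
    rw [Language.Formula.realize_relabel, hφ] at hi
    exact ⟨i 0, hi⟩
  · rintro ⟨x, hx⟩
    refine ⟨fun _ => x, ?_⟩
    rw [Language.Formula.realize_relabel, hφ]
    exact hx

lemma all {P : (ℕ → ℝ) → ℝ → Prop}
    (hP : DefinablePred f fun v => P (fun i => v (i + 1)) (v 0)) :
    DefinablePred f fun v => ∀ x, P v x :=
  (ex (P := fun v x => ¬ P v x) hP.not).not.congr fun v => by push Not; rfl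

end DefinablePred

lemma DefinableFun.subst {P : (ℕ → ℝ) → ℝ → Prop} {t : (ℕ → ℝ) → ℝ} (ht : DefinableFun f t)
    (hP : DefinablePred f fun v => P (fun i => v (i + 1)) (v 0)) :
    DefinablePred f fun v => P v (t v) :=
  (DefinablePred.ex (P := fun v x => x = t v ∧ P v x) (ht.and hP)).congr fun v => by simp

/-- Substitution of definable functions into a definable binary relation. -/
lemma DefinablePred.comp₂ {R : ℝ → ℝ → Prop} {s t : (ℕ → ℝ) → ℝ}
    (hR : DefinablePred f fun v => R (v 0) (v 1)) (hs : DefinableFun f s)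
    (ht : DefinableFun f t) : DefinablePred f fun v => R (s v) (t v) := by
  refine hs.subst (P := fun v x => R x (t v)) ?_
  refine DefinableFun.subst (t := fun v => t fun i => v (i + 1))
    (P := fun v y => R (v 0) y) ?_ ?_
  · exact ht.reindex (consIdx 0 (· + 2))
  · exact hR.reindex (consIdx 1 fun _ => 0)

lemma DefinablePred.eq_var : DefinablePred f fun v => v 0 = v 1 :=
  ⟨Language.Term.equal (Language.var 0) (Language.var 1), fun v => by
    simp [Language.Formula.realize_equal]⟩

lemma DefinablePred.eq {s t : (ℕ → ℝ) → ℝ} (hs : DefinableFun f s) (ht : DefinableFun f t) :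
    DefinablePred f fun v => s v = t v :=
  DefinablePred.eq_var.comp₂ hs ht

namespace DefinableFun

lemma var (i : ℕ) : DefinableFun f fun v => v i :=
  DefinablePred.eq_var.reindex (consIdx 0 fun _ => i + 1)

lemma const (r : ℝ) : DefinableFun f fun _ => r :=
  ⟨Language.Term.equal (Language.var 0)
    (Language.Term.func (L := RbarLang f) (RbarFunc.const r : (RbarLang f).Functions 0)
      Fin.elim0), fun v => by
    rw [Language.Formula.realize_equal]; rfl⟩

lemma add_var : DefinableFun f fun v => v 0 + v 1 :=
  ⟨Language.Term.equal (Language.var 0)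
    (Language.Term.func (L := RbarLang f) (RbarFunc.add : (RbarLang f).Functions 2)
      ![Language.var 1, Language.var 2]), fun v => by
    rw [Language.Formula.realize_equal]; rfl⟩

lemma mul_var : DefinableFun f fun v => v 0 * v 1 :=
  ⟨Language.Term.equal (Language.var 0)
    (Language.Term.func (L := RbarLang f) (RbarFunc.mul : (RbarLang f).Functions 2)
      ![Language.var 1, Language.var 2]), fun v => by
    rw [Language.Formula.realize_equal]; rfl⟩

lemma shift {t : (ℕ → ℝ) → ℝ} (ht : DefinableFun f t) :
    DefinableFun f fun v => t fun i => v (i + 1) :=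
  ht.reindex (consIdx 0 (· + 2))

lemma comp₂ {h : ℝ → ℝ → ℝ} (hh : DefinableFun f fun v => h (v 0) (v 1)) {s t : (ℕ → ℝ) → ℝ}
    (hs : DefinableFun f s) (ht : DefinableFun f t) : DefinableFun f fun v => h (s v) (t v) := by
  refine hs.shift.subst (P := fun v x => v 0 = h x (t fun i => v (i + 1))) ?_
  refine ht.shift.shift.subst (P := fun v y => v 1 = h (v 0) y) ?_
  exact hh.reindex (consIdx 2 (consIdx 1 fun _ => 0))

lemma add {s t : (ℕ → ℝ) → ℝ} (hs : DefinableFun f s) (ht : DefinableFun f t) :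
    DefinableFun f fun v => s v + t v :=
  comp₂ add_var hs ht

lemma mul {s t : (ℕ → ℝ) → ℝ} (hs : DefinableFun f s) (ht : DefinableFun f t) :
    DefinableFun f fun v => s v * t v :=
  comp₂ mul_var hs ht

lemma sub {s t : (ℕ → ℝ) → ℝ} (hs : DefinableFun f s) (ht : DefinableFun f t) :
    DefinableFun f fun v => s v - t v :=
  (hs.add ((const (-1)).mul ht)).congr fun v => by simp only [neg_one_mul, sub_eq_add_neg]

lemma pow {t : (ℕ → ℝ) → ℝ} (ht : DefinableFun f t) (n : ℕ) : DefinableFun f fun v => t v ^ n := by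
  induction n with
  | zero => simpa using const 1
  | succ n ih => simpa only [pow_succ] using ih.mul ht

lemma inv {t : (ℕ → ℝ) → ℝ} (ht : DefinableFun f t) : DefinableFun f fun v => (t v)⁻¹ := by
  refine (((DefinablePred.eq ((var 0).mul ht.shift) (const 1))).or
    ((DefinablePred.eq ht.shift (const 0)).and (DefinablePred.eq (var 0) (const 0)))).congr
      fun v => ?_
  rcases eq_or_ne (t fun i => v (i + 1)) 0 with h | h
  · simp [h]
  · simpa [h] using ⟨fun e => by rw [e, inv_mul_cancel₀ h], eq_inv_of_mul_eq_one_left⟩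

lemma div {s t : (ℕ → ℝ) → ℝ} (hs : DefinableFun f s) (ht : DefinableFun f t) :
    DefinableFun f fun v => s v / t v :=
  hs.mul ht.inv

lemma comp {h : ℝ → ℝ} (hh : DefinableFun f fun v => h (v 0)) {t : (ℕ → ℝ) → ℝ}
    (ht : DefinableFun f t) : DefinableFun f fun v => h (t v) :=
  comp₂ (h := fun x _ => h x) hh ht ht

end DefinableFun

namespace DefinablePred

lemma lt {s t : (ℕ → ℝ) → ℝ} (hs : DefinableFun f s) (ht : DefinableFun f t) :
    DefinablePred f fun v => s v < t v := by
  refine comp₂ (R := fun x y => x < y) ?_ hs ht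
  -- `x < y` holds if and only if `(y - x) * z ^ 2 = 1` for some `z`
  refine (ex (P := fun v z => (v 1 - v 0) * (z * z) = 1)
    (DefinablePred.eq (((DefinableFun.var 2).sub (.var 1)).mul
      ((DefinableFun.var 0).mul (.var 0))) (.const 1))).congr fun v => ?_
  constructor
  · intro h
    have h' : 0 < v 1 - v 0 := sub_pos.2 h
    refine ⟨(Real.sqrt (v 1 - v 0))⁻¹, ?_⟩
    rw [← mul_inv, Real.mul_self_sqrt h'.le, mul_inv_cancel₀ h'.ne']
  · rintro ⟨z, hz⟩
    by_contra! h
    nlinarith [mul_nonneg (sub_nonneg.2 h) (mul_self_nonneg z)]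

lemma le {s t : (ℕ → ℝ) → ℝ} (hs : DefinableFun f s) (ht : DefinableFun f t) :
    DefinablePred f fun v => s v ≤ t v :=
  (lt ht hs).not.congr fun _ => not_lt.symm

lemma mem_graph (i : ι) : DefinablePred f fun v => v 1 ∈ f i (v 0) :=
  ⟨Language.Relations.formula (L := RbarLang f) (GraphRel.graph i : (RbarLang f).Relations 2)
    ![Language.var 0, Language.var 1], fun v => by
    exact Language.Formula.realize_rel⟩

/-- A limit at infinity of a definable function with parameters is definable. -/
lemma tendsto_atTop {h : (ℕ → ℝ) → ℝ → ℝ} {t : (ℕ → ℝ) → ℝ}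
    (hh : DefinableFun f fun v => h (fun i => v (i + 1)) (v 0)) (ht : DefinableFun f t) :
    DefinablePred f fun v => Filter.Tendsto (h v) Filter.atTop (nhds (t v)) := by
  have key : DefinablePred f fun v => ∀ ε : ℝ, 0 < ε → ∃ N : ℝ, ∀ x : ℝ, N ≤ x →
      h v x < t v + ε ∧ t v < h v x + ε := by
    refine .all (.imp (.lt (.const 0) (.var 0)) (.ex (.all (.imp (.le (.var 1) (.var 0)) ?_))))
    have h1 : DefinableFun f fun v => h (fun i => v (i + 1 + 1 + 1)) (v 0) :=
      hh.reindex (consIdx 0 (consIdx 1 (· + 4)))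
    have h2 : DefinableFun f fun v => t (fun i => v (i + 1 + 1 + 1)) := ht.shift.shift.shift
    exact .and (.lt h1 (h2.add (.var 2))) (.lt h2 (h1.add (.var 2)))
  refine key.congr fun v => ?_
  rw [Metric.tendsto_atTop]
  refine forall₂_congr fun ε _ => exists_congr fun N => forall₂_congr fun x _ => ?_
  rw [Real.dist_eq, abs_sub_lt_iff]
  constructor <;> rintro ⟨h1, h2⟩ <;> constructor <;> linarith

/-- A definable predicate on the reals gives a definable set in the sense of the statement. -/
lemma rbarDefines {S : Set ℝ} (hS : DefinablePred f fun v => v 0 ∈ S) : RbarDefines f S := by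
  obtain ⟨φ, hφ⟩ := hS
  rw [RbarDefines, Set.Definable₁, Set.empty_definable_iff]
  refine ⟨φ.relabel fun _ => 0, ?_⟩
  ext v
  change v 0 ∈ S ↔ (φ.relabel fun _ => 0).Realize v
  rw [Language.Formula.realize_relabel, hφ]
  rfl

end DefinablePred

end Definability

/-! ### Coding the integers by approximations to a real number -/

section Approximation

open MeasureTheory Set

/-- An infinite set of reals has two points between which there is none of finitely many given
points. -/
lemma Set.Infinite.exists_lt_forall_notMem_Ioo {G : Set ℝ} (hG : G.Infinite) (φ : ℕ → ℝ) (M : ℕ) :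
    ∃ a ∈ G, ∃ b ∈ G, a < b ∧ ∀ i < M, φ i ∉ Ioo a b := by
  classical
  obtain ⟨a, ha, b, hb, hab, h⟩ := hG.exists_ne_map_eq_of_mapsTo
    (f := fun c => (Finset.range M).filter fun i => φ i < c)
    (t := ((Finset.range M).powerset : Set (Finset ℕ)))
    (fun c _ => Finset.mem_coe.2 (Finset.mem_powerset.2 (Finset.filter_subset _ _)))
    (Finset.finite_toSet _)
  wlog hlt : a < b generalizing a b
  · exact this b hb a ha hab.symm h.symm (lt_of_le_of_ne (not_lt.1 hlt) hab.symm)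
  refine ⟨a, ha, b, hb, hlt, fun i hi hm => ?_⟩
  have h1 : i ∈ (Finset.range M).filter fun i => φ i < b := by simp [hi, hm.2]
  rw [← h] at h1
  exact (Finset.mem_filter.1 h1).2.not_gt hm.1

/-- The points of `(a, b)` that are farther than `γ⁻¹ ^ i` from `φ i` for each `i ≥ N`. -/
def farPoints (γ : ℝ) (φ : ℕ → ℝ) (a b : ℝ) (N : ℕ) : Set ℝ :=
  {c ∈ Ioo a b | ∀ i ≥ N, γ⁻¹ ^ i < |c - φ i|}

variable {γ : ℝ} {φ : ℕ → ℝ}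

lemma tsum_pow_add_eq (hγ : 1 < γ) (N : ℕ) :
    ∑' i, γ⁻¹ ^ (N + i) = γ⁻¹ ^ N * (1 - γ⁻¹)⁻¹ := by
  simp_rw [pow_add]
  rw [tsum_mul_left, tsum_geometric_of_lt_one (by positivity) (inv_lt_one_of_one_lt₀ hγ)]

/-- The removed intervals with indices from `Q` on have total length less than `b - a`. -/
lemma farPoints_infinite (hγ : 1 < γ) {a b : ℝ} {N Q : ℕ}
    (hQ : 2 * (γ⁻¹ ^ Q * (1 - γ⁻¹)⁻¹) < b - a)
    (hN : ∀ i, N ≤ i → i < Q → ∀ c ∈ Ioo a b, γ⁻¹ ^ i < |c - φ i|) :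
    (farPoints γ φ a b N).Infinite := by
  have hγ0 : 0 < γ := by linarith
  have hγ1 : γ⁻¹ < 1 := inv_lt_one_of_one_lt₀ hγ
  intro hfin
  have hsub : Ioo a b ⊆
      farPoints γ φ a b N ∪ ⋃ i : ℕ, Metric.closedBall (φ (Q + i)) (γ⁻¹ ^ (Q + i)) := by
    intro c hc
    by_cases h : c ∈ farPoints γ φ a b N
    · exact Or.inl h
    · right
      have h' : ∃ i, N ≤ i ∧ |c - φ i| ≤ γ⁻¹ ^ i := by
        by_contra! h'
        exact h ⟨hc, h'⟩
      obtain ⟨i, hi, hci⟩ := h'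
      have hiQ : Q ≤ i := by
        by_contra! hlt
        exact (hN i hi hlt c hc).not_ge hci
      refine mem_iUnion.2 ⟨i - Q, ?_⟩
      rw [Nat.add_sub_cancel' hiQ, Metric.mem_closedBall, Real.dist_eq]
      exact hci
  have hsum : Summable fun i : ℕ => 2 * γ⁻¹ ^ (Q + i) := by
    simp_rw [pow_add, ← mul_assoc]
    exact (summable_geometric_of_lt_one (by positivity) hγ1).mul_left _
  have h1 : volume (Ioo a b) ≤ ENNReal.ofReal (2 * (γ⁻¹ ^ Q * (1 - γ⁻¹)⁻¹)) := by
    calc volume (Ioo a b)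
        ≤ volume (farPoints γ φ a b N) +
          volume (⋃ i : ℕ, Metric.closedBall (φ (Q + i)) (γ⁻¹ ^ (Q + i))) :=
          (measure_mono hsub).trans (measure_union_le _ _)
      _ ≤ 0 + ∑' i : ℕ, volume (Metric.closedBall (φ (Q + i)) (γ⁻¹ ^ (Q + i))) :=
          add_le_add (hfin.measure_zero volume).le (measure_iUnion_le _)
      _ = ∑' i : ℕ, ENNReal.ofReal (2 * γ⁻¹ ^ (Q + i)) := by
          simp_rw [Real.volume_closedBall, zero_add]
      _ = ENNReal.ofReal (∑' i : ℕ, 2 * γ⁻¹ ^ (Q + i)) :=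
          (ENNReal.ofReal_tsum_of_nonneg (fun i => by positivity) hsum).symm
      _ = _ := by rw [tsum_mul_left, tsum_pow_add_eq hγ]
  rw [Real.volume_Ioo] at h1
  have h0 : 0 < 1 - γ⁻¹ := by linarith
  have := (ENNReal.ofReal_le_ofReal_iff (by positivity)).1 h1
  linarith

lemma exists_geometric_tail_lt (hγ : 1 < γ) {ε : ℝ} (hε : 0 < ε) :
    ∃ Q : ℕ, 2 * (γ⁻¹ ^ Q * (1 - γ⁻¹)⁻¹) < ε := by
  have hγ0 : 0 < γ := by linarith
  have h0 : 0 < 1 - γ⁻¹ := sub_pos.2 (inv_lt_one_of_one_lt₀ hγ)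
  obtain ⟨Q, hQ⟩ := exists_pow_lt_of_lt_one (show 0 < ε / 2 * (1 - γ⁻¹) by positivity)
    (inv_lt_one_of_one_lt₀ hγ)
  refine ⟨Q, ?_⟩
  rw [← div_eq_mul_inv]
  have := (div_lt_iff₀ h0).2 hQ
  linarith

/-- One step of the nested interval construction. The interval `[a', b']` to the right of `φ j`
is where `1 / (γ ^ j * (c - φ j))` lies between `n + 2` and `n + 2 + 1 / (n + 1)`. The index `j`
is the least one from `N` on with `φ j` between two far points, so that no earlier interval
`(φ i, φ i + γ⁻¹ ^ i)` reaches `[a', b']`. -/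
lemma exists_nested_interval (hγ : 1 < γ)
    (hd : ∀ a b, a < b → 1 < a → b < γ → ∀ N, ∃ j ≥ N, φ j ∈ Ioo a b)
    (hs : ∀ Q : ℕ, ∃ κ > 0, ∀ j, ∀ i, j < i → i ≤ j + Q → κ ≤ |φ i - φ j|)
    {a b : ℝ} {N : ℕ} (ha : 1 ≤ a) (hb : b ≤ γ) (hG : (farPoints γ φ a b N).Infinite) (n : ℕ) :
    ∃ a' b' j, a < a' ∧ a' < b' ∧ b' < b ∧ N ≤ j ∧ (farPoints γ φ a' b' (j + 1)).Infinite ∧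
      ∀ c ∈ Icc a' b', (∀ i, N ≤ i → i < j → ¬ (0 < c - φ i ∧ γ ^ i * (c - φ i) < 1)) ∧
        0 < c - φ j ∧ (n : ℝ) + 2 ≤ (γ ^ j * (c - φ j))⁻¹ ∧
          (γ ^ j * (c - φ j))⁻¹ ≤ n + 2 + 1 / (n + 1) := by
  classical
  have hγ0 : 0 < γ := by linarith
  have hγ1 : γ⁻¹ < 1 := inv_lt_one_of_one_lt₀ hγ
  have hn : (0 : ℝ) < n + 1 := by positivity
  obtain ⟨p, hp⟩ : ∃ p : ℝ, p = ((n : ℝ) + 2 + 1 / (n + 1))⁻¹ := ⟨_, rfl⟩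
  obtain ⟨q, hq⟩ : ∃ q : ℝ, q = ((n : ℝ) + 2)⁻¹ := ⟨_, rfl⟩
  have hp0 : 0 < p := by rw [hp]; positivity
  have hpq : p < q := by
    rw [hp, hq]
    exact inv_strictAnti₀ (by positivity) (by linarith [show 0 < 1 / ((n : ℝ) + 1) by positivity])
  have hq1 : q ≤ 1 := by
    rw [hq]; exact inv_le_one_of_one_le₀ (by linarith)
  -- the new interval has length `γ⁻¹ ^ j * (q - p)`: indices beyond `j + Q` cover less than that,
  -- and those between `j` and `j + Q` are kept away by `κ` as soon as `j ≥ M`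
  obtain ⟨Q, hQ⟩ := exists_geometric_tail_lt hγ (sub_pos.2 hpq)
  obtain ⟨κ, hκ, hsep⟩ := hs Q
  obtain ⟨M, hM⟩ := exists_pow_lt_of_lt_one (half_pos hκ) hγ1
  obtain ⟨c₁, hc₁, c₂, hc₂, hlt, hempty⟩ := hG.exists_lt_forall_notMem_Ioo φ M
  have hex : ∃ j, N ≤ j ∧ φ j ∈ Ioo c₁ c₂ := by
    obtain ⟨j, hj, hm⟩ := hd c₁ c₂ hlt (ha.trans_lt hc₁.1.1) (hc₂.1.2.trans_le hb) N
    exact ⟨j, hj, hm⟩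
  obtain ⟨j, ⟨hNj, hj⟩, hmin⟩ : ∃ j, (N ≤ j ∧ φ j ∈ Ioo c₁ c₂) ∧
      ∀ i < j, ¬ (N ≤ i ∧ φ i ∈ Ioo c₁ c₂) :=
    ⟨Nat.find hex, Nat.find_spec hex, fun i hi => Nat.find_min hex hi⟩
  have hMj : M ≤ j := by
    by_contra! h
    exact hempty j h hj
  have hj0 : 0 < γ⁻¹ ^ j := by positivity
  have hjκ : γ⁻¹ ^ j < κ / 2 := (pow_le_pow_of_le_one (by positivity) hγ1.le hMj).trans_lt hM
  have hfar₁ := hc₁.2 j hNj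
  have hfar₂ := hc₂.2 j hNj
  rw [abs_of_neg (by linarith [hj.1])] at hfar₁
  rw [abs_of_pos (by linarith [hj.2])] at hfar₂
  have hqj : γ⁻¹ ^ j * q ≤ γ⁻¹ ^ j := mul_le_of_le_one_right hj0.le hq1
  have hpqj : γ⁻¹ ^ j * p < γ⁻¹ ^ j * q := mul_lt_mul_of_pos_left hpq hj0
  have hpj : 0 < γ⁻¹ ^ j * p := by positivity
  have hγj : γ ^ j * γ⁻¹ ^ j = 1 := by rw [← mul_pow, mul_inv_cancel₀ hγ0.ne', one_pow]
  refine ⟨φ j + γ⁻¹ ^ j * p, φ j + γ⁻¹ ^ j * q, j, by linarith [hj.1, hc₁.1.1], by linarith,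
    by linarith [hc₂.1.2], hNj, ?_, fun c hc => ⟨fun i hi hij => ?_, ?_, ?_, ?_⟩⟩
  · refine farPoints_infinite (Q := j + Q) hγ ?_ fun i hi hiQ c hc => ?_
    · rw [pow_add]
      have := mul_lt_mul_of_pos_left hQ hj0
      linarith
    · have h1 := hsep j i hi hiQ.le
      have h2 : |c - φ j| < γ⁻¹ ^ j := by
        rw [abs_of_pos (by linarith [hc.1])]
        linarith [hc.2]
      have h3 : γ⁻¹ ^ i ≤ γ⁻¹ ^ j :=
        pow_le_pow_of_le_one (by positivity) hγ1.le (by omega)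
      have h4 : |φ i - φ j| ≤ |c - φ j| + |c - φ i| := by
        have := abs_sub (c - φ j) (c - φ i)
        rwa [show c - φ j - (c - φ i) = φ i - φ j by ring] at this
      linarith
  · rintro ⟨h1, h2⟩
    have hi' := hmin i hij
    rw [not_and] at hi'
    have hγi : γ ^ i * γ⁻¹ ^ i = 1 := by rw [← mul_pow, mul_inv_cancel₀ hγ0.ne', one_pow]
    have h2' : c - φ i < γ⁻¹ ^ i := by
      by_contra! h
      have := mul_le_mul_of_nonneg_left h (pow_pos hγ0 i).le
      linarith
    rcases le_or_gt (φ i) c₁ with h | h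
    · have := hc₁.2 i hi
      rw [abs_of_nonneg (by linarith)] at this
      linarith [hc.1, hj.1]
    · have h3 : c₂ ≤ φ i := by
        by_contra! h'
        exact hi' hi ⟨h, h'⟩
      linarith [hc.2]
  · linarith [hc.1]
  · have h1 : γ ^ j * (c - φ j) ≤ q := by
      have := mul_le_mul_of_nonneg_left (show c - φ j ≤ γ⁻¹ ^ j * q by linarith [hc.2])
        (pow_pos hγ0 j).le
      rwa [← mul_assoc, hγj, one_mul] at this
    have h0 : 0 < γ ^ j * (c - φ j) := mul_pos (pow_pos hγ0 j) (by linarith [hc.1])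
    have := inv_anti₀ h0 h1
    rwa [hq, inv_inv] at this
  · have h1 : p ≤ γ ^ j * (c - φ j) := by
      have := mul_le_mul_of_nonneg_left (show γ⁻¹ ^ j * p ≤ c - φ j by linarith [hc.1])
        (pow_pos hγ0 j).le
      rwa [← mul_assoc, hγj, one_mul] at this
    have := inv_anti₀ hp0 h1
    rwa [hp, inv_inv] at this

/-- There is a real `c` such that the numbers `1 / (γ ^ i * (c - φ i))` exceeding `1` are,
from some index on, a sequence asymptotic to `n + 2`. -/
lemma exists_coding_real (hγ : 1 < γ)
    (hd : ∀ a b, a < b → 1 < a → b < γ → ∀ N, ∃ j ≥ N, φ j ∈ Ioo a b)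
    (hs : ∀ Q : ℕ, ∃ κ > 0, ∀ j, ∀ i, j < i → i ≤ j + Q → κ ≤ |φ i - φ j|) :
    ∃ (c : ℝ) (N : ℕ) (J : ℕ → ℕ),
      (∀ i, N ≤ i → (0 < c - φ i ∧ γ ^ i * (c - φ i) < 1 ↔ ∃ n, J n = i)) ∧
      (∀ n, N ≤ J n) ∧
      ∀ n : ℕ, (n : ℝ) + 2 ≤ (γ ^ J n * (c - φ (J n)))⁻¹ ∧
        (γ ^ J n * (c - φ (J n)))⁻¹ ≤ n + 2 + 1 / (n + 1) := by
  obtain ⟨N, hN⟩ := exists_geometric_tail_lt hγ (sub_pos.2 hγ)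
  have h0 : (farPoints γ φ 1 γ N).Infinite :=
    farPoints_infinite hγ hN fun i h1 h2 => absurd h1 (by omega)
  -- a state `(a, b, K)` is the current interval with the first index not yet decided
  let S := {x : ℝ × ℝ × ℕ // 1 ≤ x.1 ∧ x.2.1 ≤ γ ∧ (farPoints γ φ x.1 x.2.1 x.2.2).Infinite}
  have step : ∀ (n : ℕ) (x : S), ∃ y : S, ∃ j : ℕ, y.1.2.2 = j + 1 ∧
      x.1.1 < y.1.1 ∧ y.1.1 < y.1.2.1 ∧ y.1.2.1 < x.1.2.1 ∧ x.1.2.2 ≤ j ∧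
      ∀ c ∈ Icc y.1.1 y.1.2.1,
        (∀ i, x.1.2.2 ≤ i → i < j → ¬ (0 < c - φ i ∧ γ ^ i * (c - φ i) < 1)) ∧
        0 < c - φ j ∧ (n : ℝ) + 2 ≤ (γ ^ j * (c - φ j))⁻¹ ∧
          (γ ^ j * (c - φ j))⁻¹ ≤ n + 2 + 1 / (n + 1) := by
    rintro n ⟨⟨a, b, K⟩, ha, hb, hG⟩
    obtain ⟨a', b', j, h1, h2, h3, h4, h5, h6⟩ := exists_nested_interval hγ hd hs ha hb hG n
    exact ⟨⟨⟨a', b', j + 1⟩, by simp only at ha ⊢; linarith, by simp only at hb ⊢; linarith, h5⟩,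
      j, rfl, h1, h2, h3, h4, h6⟩
  choose nxt J hJ using step
  let s : ℕ → S := fun n => Nat.rec ⟨⟨1, γ, N⟩, le_rfl, le_rfl, h0⟩ (fun n x => nxt n x) n
  have hsucc : ∀ n, s (n + 1) = nxt n (s n) := fun n => rfl
  let a : ℕ → ℝ := fun n => (s n).1.1
  let b : ℕ → ℝ := fun n => (s n).1.2.1
  let K : ℕ → ℕ := fun n => (s n).1.2.2
  let j : ℕ → ℕ := fun n => J n (s n)
  have hK0 : K 0 = N := rfl
  have hK : ∀ n, K (n + 1) = j n + 1 := fun n => (hJ n (s n)).1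
  have ha : ∀ n, a n < a (n + 1) := fun n => (hJ n (s n)).2.1
  have hab' : ∀ n, a (n + 1) < b (n + 1) := fun n => (hJ n (s n)).2.2.1
  have hb : ∀ n, b (n + 1) < b n := fun n => (hJ n (s n)).2.2.2.1
  have hKj : ∀ n, K n ≤ j n := fun n => (hJ n (s n)).2.2.2.2.1
  have hc := fun n => (hJ n (s n)).2.2.2.2.2
  have hab : ∀ n, a n ≤ b n := by
    rintro (_ | n)
    · exact hγ.le
    · exact (hab' n).le
  have hmem := Monotone.ciSup_mem_iInter_Icc_of_antitone
    (monotone_nat_of_le_succ fun n => (ha n).le) (antitone_nat_of_succ_le fun n => (hb n).le) hab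
  obtain ⟨c, hcdef⟩ : ∃ c : ℝ, c = ⨆ n, a n := ⟨_, rfl⟩
  rw [← hcdef, mem_iInter] at hmem
  have hcn := fun n => hc n c (hmem (n + 1))
  have hKle : ∀ n, N ≤ K n := by
    intro n
    induction n with
    | zero => exact hK0.ge
    | succ n ih => have := hKj n; have := hK n; omega
  have hKlt : ∀ n, n ≤ K n := by
    intro n
    induction n with
    | zero => omega
    | succ n ih => have := hKj n; have := hK n; omega
  refine ⟨c, N, j, fun i hi => ⟨fun h => ?_, ?_⟩, fun n => (hKle n).trans (hKj n),
    fun n => (hcn n).2.2⟩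
  · have key : ∀ m, i < K m → ∃ n, j n = i := by
      intro m
      induction m with
      | zero => intro h; omega
      | succ m ih =>
        intro him
        rcases lt_or_ge i (K m) with h' | h'
        · exact ih h'
        · rcases lt_or_ge i (j m) with h'' | h''
          · exact absurd h ((hcn m).1 i h' h'')
          · exact ⟨m, by have := hK m; omega⟩
    exact key (i + 1) (hKlt (i + 1))
  · rintro ⟨n, rfl⟩
    obtain ⟨-, h1, h2, -⟩ := hcn n
    refine ⟨h1, ?_⟩
    have h3 : (1 : ℝ) < (γ ^ j n * (c - φ (j n)))⁻¹ :=
      lt_of_lt_of_le (by linarith [(Nat.cast_nonneg n : (0 : ℝ) ≤ n)]) h2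
    have h4 : 0 < γ ^ j n * (c - φ (j n)) := mul_pos (pow_pos (by linarith) _) h1
    exact (one_lt_inv₀ h4).1 h3

end Approximation

/-! ### The fractional parts of the multiples of an irrational number -/

section FractionalParts

open Set

lemma Irrational.exists_fract_mem_Ioo {r : ℝ} (hr : Irrational r) {x y : ℝ} (hxy : x < y)
    (hx : 0 ≤ x) (hy : y ≤ 1) (N : ℕ) : ∃ j ≥ N, Int.fract ((j : ℝ) * r) ∈ Ioo x y := by
  have hd : DenseRange (fun i : ℕ => i • (r : AddCircle (1 : ℝ))) :=
    denseRange_zsmul_iff_nsmul.1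
      (AddCircle.denseRange_zsmul_coe_iff.2 (by rwa [div_one]))
  have hU : IsOpen ((fun t : ℝ => (t : AddCircle (1 : ℝ))) '' Ioo x y) :=
    QuotientAddGroup.isOpenMap_coe _ isOpen_Ioo
  obtain ⟨t, ht⟩ := exists_between hxy
  obtain ⟨i, hi⟩ := hd.exists_mem_open
    (hU.preimage (continuous_add_const ((N • r : ℝ) : AddCircle (1 : ℝ))))
    ⟨(t : AddCircle (1 : ℝ)) - ((N • r : ℝ) : AddCircle (1 : ℝ)), ⟨t, ht, by simp⟩⟩
  obtain ⟨u, hu, hui⟩ := hi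
  refine ⟨i + N, by omega, ?_⟩
  have h1 : ((u : ℝ) : AddCircle (1 : ℝ)) = (((i + N : ℕ) : ℝ) * r : ℝ) := by
    simp only at hui
    rw [hui, ← AddCircle.coe_nsmul, ← AddCircle.coe_add]
    congr 1
    push_cast
    simp only [nsmul_eq_mul]
    ring
  obtain ⟨n, hn⟩ := AddCircle.coe_eq_zero_iff (1 : ℝ) |>.1
    (show (((((i + N : ℕ) : ℝ) * r - u : ℝ)) : AddCircle (1 : ℝ)) = 0 by
      rw [AddCircle.coe_sub, h1, sub_self])
  rw [zsmul_one] at hn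
  rw [show ((i + N : ℕ) : ℝ) * r = u + n by linarith, Int.fract_add_intCast,
    Int.fract_eq_self.2 ⟨hx.trans hu.1.le, hu.2.trans_le hy⟩]
  exact hu

lemma Irrational.rpow_fract_dense {γ r : ℝ} (hγ : 1 < γ) (hr : Irrational r) (a b : ℝ)
    (hab : a < b) (ha : 1 < a) (hb : b < γ) (N : ℕ) :
    ∃ j ≥ N, γ ^ Int.fract ((j : ℝ) * r) ∈ Ioo a b := by
  have hγ0 : 0 < γ := by linarith
  have ha0 : 0 < a := by linarith
  obtain ⟨j, hj, h1, h2⟩ := hr.exists_fract_mem_Ioo (Real.logb_lt_logb hγ ha0 hab)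
    (Real.logb_pos hγ ha).le (Real.logb_le_logb_of_le hγ (by linarith) hb.le |>.trans_eq
      (Real.logb_self_eq_one hγ)) N
  refine ⟨j, hj, ?_, ?_⟩
  · rwa [← Real.logb_lt_iff_lt_rpow hγ ha0]
  · rwa [← Real.lt_logb_iff_rpow_lt hγ (by linarith)]

/-- Terms with distinct indices at most `Q` apart are uniformly separated. -/
lemma Irrational.rpow_fract_separated {γ r : ℝ} (hγ : 1 < γ) (hr : Irrational r) (Q : ℕ) :
    ∃ κ > 0, ∀ j i : ℕ, j < i → i ≤ j + Q →
      κ ≤ |γ ^ Int.fract ((i : ℝ) * r) - γ ^ Int.fract ((j : ℝ) * r)| := by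
  have hγ0 : 0 < γ := by linarith
  induction Q with
  | zero => exact ⟨1, one_pos, fun j i h1 h2 => absurd h1 (by omega)⟩
  | succ Q ih =>
    obtain ⟨κ, hκ, h⟩ := ih
    obtain ⟨δ, hδ⟩ : ∃ δ : ℝ, δ = Int.fract (((Q + 1 : ℕ) : ℝ) * r) := ⟨_, rfl⟩
    have hδ0 : 0 < δ := by
      rw [hδ, Int.fract_pos]
      exact (hr.natCast_mul (Nat.succ_ne_zero Q)).ne_int _
    have hδ1 : δ < 1 := hδ ▸ Int.fract_lt_one _
    have h1 : 1 < γ ^ δ := Real.one_lt_rpow hγ hδ0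
    have h2 : γ ^ (δ - 1) < 1 := Real.rpow_lt_one_of_one_lt_of_neg hγ (by linarith)
    refine ⟨min κ (min (γ ^ δ - 1) (1 - γ ^ (δ - 1))),
      lt_min hκ (lt_min (by linarith) (by linarith)), fun j i hji hi => ?_⟩
    rcases Nat.lt_or_ge i (j + (Q + 1)) with hlt | hge
    · exact (min_le_left _ _).trans (h j i hji (by omega))
    · obtain rfl : i = j + (Q + 1) := by omega
      refine (min_le_right _ _).trans ?_
      obtain ⟨z, hz⟩ := Int.fract_add ((j : ℝ) * r) (((Q + 1 : ℕ) : ℝ) * r)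
      rw [← add_mul, ← Nat.cast_add, ← hδ] at hz
      have hf := Int.fract_nonneg ((j : ℝ) * r)
      have hf1 := Int.fract_lt_one ((j : ℝ) * r)
      have hg := Int.fract_nonneg (((j + (Q + 1) : ℕ) : ℝ) * r)
      have hg1 := Int.fract_lt_one (((j + (Q + 1) : ℕ) : ℝ) * r)
      have hz1 : (-2 : ℝ) < z := by linarith
      have hz2 : (z : ℝ) < 1 := by linarith
      have hz1' : (-2 : ℤ) < z := by exact_mod_cast hz1
      have hz2' : z < 1 := by exact_mod_cast hz2
      have hpos : 1 ≤ γ ^ Int.fract ((j : ℝ) * r) := Real.one_le_rpow hγ.le hf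
      have hcase : z = 0 ∨ z = -1 := by omega
      rcases hcase with rfl | rfl
      · have he : Int.fract (((j + (Q + 1) : ℕ) : ℝ) * r) = Int.fract ((j : ℝ) * r) + δ := by
          push_cast at hz ⊢; linarith
        rw [he, Real.rpow_add hγ0]
        refine (min_le_left _ _).trans (le_trans ?_ (le_abs_self _))
        nlinarith
      · have he : Int.fract (((j + (Q + 1) : ℕ) : ℝ) * r) =
            Int.fract ((j : ℝ) * r) + (δ - 1) := by
          push_cast at hz ⊢; linarith
        rw [he, Real.rpow_add hγ0]
        refine (min_le_right _ _).trans (le_trans ?_ (neg_le_abs _))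
        nlinarith

/-- The representative of `(γ ^ j) ^ r` in `[1, γ)` modulo powers of `γ`. -/
lemma exists_zpow_mul_eq_iff {γ : ℝ} (hγ : 1 < γ) (r z : ℝ) (j : ℕ) :
    (∃ m : ℤ, z = (γ ^ j) ^ r * γ ^ m ∧ 1 ≤ z ∧ z < γ) ↔ z = γ ^ Int.fract ((j : ℝ) * r) := by
  have hγ0 : 0 < γ := by linarith
  have key : ∀ m : ℤ, (γ ^ j) ^ r * γ ^ m = γ ^ ((j : ℝ) * r + m) := by
    intro m
    rw [Real.rpow_add hγ0, Real.rpow_mul hγ0.le, Real.rpow_natCast, Real.rpow_intCast]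
  constructor
  · rintro ⟨m, rfl, h1, h2⟩
    rw [key] at h1 h2 ⊢
    congr 1
    have h3 : 0 ≤ (j : ℝ) * r + m := by
      by_contra! h
      exact (Real.rpow_lt_one_of_one_lt_of_neg hγ h).not_ge h1
    have h4 : (j : ℝ) * r + m < 1 := by
      by_contra! h
      have := Real.rpow_le_rpow_of_exponent_le hγ.le h
      rw [Real.rpow_one] at this
      linarith
    rw [← Int.fract_add_intCast _ m]
    exact (Int.fract_eq_self.2 ⟨h3, h4⟩).symm
  · rintro rfl
    refine ⟨-⌊(j : ℝ) * r⌋, ?_, Real.one_le_rpow hγ.le (Int.fract_nonneg _), ?_⟩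
    · rw [key]; congr 1; rw [Int.fract]; push_cast; ring
    · calc _ < γ ^ (1 : ℝ) := Real.rpow_lt_rpow_of_exponent_lt hγ (Int.fract_lt_one _)
        _ = γ := Real.rpow_one γ

end FractionalParts

/-! ### Logarithmic derivatives of canonical products -/

section CanonicalProduct

open Set

/-- The logarithm of the Weierstrass elementary factor of genus `k` at `-w`. -/
noncomputable def logElementaryFactor (k : ℕ) (w : ℝ) : ℝ :=
  Real.log (1 + w) + ∑ j ∈ Finset.Icc 1 k, (-1) ^ j * w ^ j / j

/-- Up to the sign `(-1) ^ k`, the contribution of the elementary factor of genus `k` at `-w` to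
`x (x G' / G)'`, that is, the image of its logarithm under `(w d/dw) ^ 2`. -/
noncomputable def eulerTerm (k : ℕ) (w : ℝ) : ℝ :=
  (k + 1) * (w ^ (k + 1) / (1 + w)) - w ^ (k + 2) / (1 + w) ^ 2

lemma logElementaryFactor_zero_right (k : ℕ) : logElementaryFactor k 0 = 0 := by
  rw [logElementaryFactor, add_zero, Real.log_one, zero_add]
  refine Finset.sum_eq_zero fun j hj => ?_
  rw [zero_pow (by have := (Finset.mem_Icc.1 hj).1; omega)]
  simp

lemma hasDerivAt_logElementaryFactor (k : ℕ) {w : ℝ} (hw : -1 < w) :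
    HasDerivAt (logElementaryFactor k) ((-w) ^ k / (1 + w)) w := by
  have h0 : 1 + w ≠ 0 := by linarith
  induction k with
  | zero =>
    have := ((hasDerivAt_id w).const_add 1).log h0
    refine (this.congr_deriv (by simp)).congr_of_eventuallyEq (Filter.Eventually.of_forall ?_)
    intro y
    simp [logElementaryFactor]
  | succ k ih =>
    have h1 : HasDerivAt (fun y : ℝ => (-1) ^ (k + 1) * y ^ (k + 1) / ((k + 1 : ℕ) : ℝ))
        ((-1) ^ (k + 1) * w ^ k) w := by
      have hk : ((k + 1 : ℕ) : ℝ) ≠ 0 := by positivity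
      refine (((hasDerivAt_pow (k + 1) w).const_mul ((-1 : ℝ) ^ (k + 1))).div_const
        ((k + 1 : ℕ) : ℝ)).congr_deriv ?_
      rw [Nat.add_sub_cancel]
      field_simp
    refine ((ih.add h1).congr_deriv ?_).congr_of_eventuallyEq (Filter.Eventually.of_forall ?_)
    · rw [neg_pow w k, neg_pow w (k + 1)]
      field_simp
      ring
    · intro y
      simp only [logElementaryFactor, Pi.add_apply]
      rw [Finset.sum_Icc_succ_top (by omega), add_assoc]

lemma hasDerivAt_mul_pow_div (k : ℕ) {w : ℝ} (hw : -1 < w) :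
    HasDerivAt (fun w : ℝ => w * ((-w) ^ k / (1 + w)))
      ((-1) ^ k * ((k + 1) * w ^ k / (1 + w) - w ^ (k + 1) / (1 + w) ^ 2)) w := by
  have h0 : 1 + w ≠ 0 := by linarith
  have h1 := ((hasDerivAt_pow (k + 1) w).div ((hasDerivAt_id w).const_add 1) h0).const_mul
    ((-1 : ℝ) ^ k)
  refine (h1.congr_deriv ?_).congr_of_eventuallyEq (Filter.Eventually.of_forall ?_)
  · rw [Nat.add_sub_cancel]
    simp only [id]
    push_cast
    field_simp
  · intro y
    simp only [Pi.div_apply, id]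
    rw [neg_pow y k]
    ring

variable {k : ℕ} {a : ℕ → ℝ} {R : ℝ}

lemma half_le_one_add_mul {a y : ℝ} (ha0 : 0 < a) (ha1 : a ≤ 1) (hy : -(1 / 2) < y) :
    1 / 2 ≤ 1 + a * y := by
  nlinarith

lemma abs_mul_le_mul {a y : ℝ} (ha0 : 0 < a) (hR : 1 ≤ R) (hy : y ∈ Ioo (-(1 / 2)) R) :
    |a * y| ≤ a * R := by
  rw [abs_mul, abs_of_pos ha0]
  exact mul_le_mul_of_nonneg_left (abs_le.2 ⟨by linarith [hy.1], hy.2.le⟩) ha0.le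

lemma abs_pow_div_pow_le {w A : ℝ} (hw : |w| ≤ A) (hw1 : 1 / 2 ≤ 1 + w) (i j : ℕ) :
    |w ^ i / (1 + w) ^ j| ≤ A ^ i * 2 ^ j := by
  rw [abs_div, abs_pow, abs_pow, abs_of_pos (show 0 < 1 + w by linarith), div_eq_mul_inv]
  refine mul_le_mul (pow_le_pow_left₀ (abs_nonneg _) hw _) ?_ (by positivity)
    (pow_nonneg ((abs_nonneg w).trans hw) _)
  rw [← inv_pow]
  refine pow_le_pow_left₀ (by positivity) ?_ _
  rw [inv_le_comm₀ (by linarith) (by norm_num)]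
  linarith

lemma summable_logElementaryFactor_and_hasDerivAt_tsum (ha0 : ∀ n, 0 < a n) (ha1 : ∀ n, a n ≤ 1)
    (hsum : Summable fun n => a n ^ (k + 1)) (hR : 1 ≤ R) {y : ℝ} (hy : y ∈ Ioo (-(1 / 2)) R) :
    (Summable fun n => logElementaryFactor k (a n * y)) ∧
      HasDerivAt (fun y => ∑' n, logElementaryFactor k (a n * y))
        (∑' n, (-(a n * y)) ^ k / (1 + a n * y) * a n) y := by
  have hu : Summable fun n => a n ^ (k + 1) * (R ^ k * 2) := hsum.mul_right _
  have hg : ∀ n, ∀ y ∈ Ioo (-(1 / 2)) R, HasDerivAt (fun y => logElementaryFactor k (a n * y))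
      ((-(a n * y)) ^ k / (1 + a n * y) * a n) y := by
    intro n y hy
    have h := half_le_one_add_mul (ha0 n) (ha1 n) hy.1
    have h1 := (hasDerivAt_id y).const_mul (a n)
    rw [mul_one] at h1
    exact (hasDerivAt_logElementaryFactor k (show -1 < a n * y by linarith)).comp y h1
  have hb : ∀ n, ∀ y ∈ Ioo (-(1 / 2)) R,
      ‖(-(a n * y)) ^ k / (1 + a n * y) * a n‖ ≤ a n ^ (k + 1) * (R ^ k * 2) := by
    intro n y hy
    have h := abs_pow_div_pow_le (abs_mul_le_mul (ha0 n) hR hy)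
      (half_le_one_add_mul (ha0 n) (ha1 n) hy.1) k 1
    rw [neg_pow, mul_div_assoc, Real.norm_eq_abs, abs_mul, abs_mul, abs_pow, abs_neg, abs_one,
      one_pow, one_mul, abs_of_pos (ha0 n)]
    rw [pow_one, pow_one] at h
    calc _ ≤ (a n * R) ^ k * 2 * a n := mul_le_mul_of_nonneg_right h (ha0 n).le
      _ = _ := by ring
  have h0 : (0 : ℝ) ∈ Ioo (-(1 / 2)) R := ⟨by norm_num, by linarith⟩
  have hs0 : Summable fun n => logElementaryFactor k (a n * 0) := by
    simp [logElementaryFactor_zero_right, summable_zero]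
  constructor
  · exact summable_of_summable_hasDerivAt_of_isPreconnected
      (g := fun n y => logElementaryFactor k (a n * y))
      (g' := fun n y => (-(a n * y)) ^ k / (1 + a n * y) * a n) hu isOpen_Ioo isPreconnected_Ioo
      hg hb h0 hs0 hy
  · exact hasDerivAt_tsum_of_isPreconnected (g := fun n y => logElementaryFactor k (a n * y))
      (g' := fun n y => (-(a n * y)) ^ k / (1 + a n * y) * a n) hu isOpen_Ioo isPreconnected_Ioo
      hg hb h0 hs0 hy

lemma hasDerivAt_tsum_mul_pow_div (ha0 : ∀ n, 0 < a n) (ha1 : ∀ n, a n ≤ 1)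
    (hsum : Summable fun n => a n ^ (k + 1)) (hR : 1 ≤ R) {y : ℝ} (hy : y ∈ Ioo (-(1 / 2)) R) :
    HasDerivAt (fun y => ∑' n, a n * y * ((-(a n * y)) ^ k / (1 + a n * y)))
      (∑' n, (-1) ^ k * ((k + 1) * (a n * y) ^ k / (1 + a n * y) -
        (a n * y) ^ (k + 1) / (1 + a n * y) ^ 2) * a n) y := by
  have hu : Summable fun n => a n ^ (k + 1) * ((k + 1) * (R ^ k * 2) + R ^ (k + 1) * 4) :=
    hsum.mul_right _
  have h0 : (0 : ℝ) ∈ Ioo (-(1 / 2)) R := ⟨by norm_num, by linarith⟩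
  refine hasDerivAt_tsum_of_isPreconnected
    (g := fun n y => a n * y * ((-(a n * y)) ^ k / (1 + a n * y)))
    (g' := fun n y => (-1) ^ k * ((k + 1) * (a n * y) ^ k / (1 + a n * y) -
        (a n * y) ^ (k + 1) / (1 + a n * y) ^ 2) * a n)
    hu isOpen_Ioo isPreconnected_Ioo ?_ ?_ h0 ?_ hy
  · intro n y hy
    have h := half_le_one_add_mul (ha0 n) (ha1 n) hy.1
    have h1 := (hasDerivAt_id y).const_mul (a n)
    rw [mul_one] at h1
    exact (hasDerivAt_mul_pow_div k (show -1 < a n * y by linarith)).comp y h1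
  · intro n y hy
    have hw := abs_mul_le_mul (ha0 n) hR hy
    have hw1 := half_le_one_add_mul (ha0 n) (ha1 n) hy.1
    have h1 := abs_pow_div_pow_le hw hw1 k 1
    have h2 := abs_pow_div_pow_le hw hw1 (k + 1) 2
    rw [pow_one, pow_one] at h1
    have hRk : 0 ≤ R ^ (k + 1) := by positivity
    have hak : 0 ≤ a n ^ (k + 1) := pow_nonneg (ha0 n).le _
    rw [Real.norm_eq_abs, abs_mul, abs_mul, abs_pow, abs_neg, abs_one, one_pow, one_mul,
      abs_of_pos (ha0 n), mul_div_assoc]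
    have h3 : |(k + 1 : ℝ) * ((a n * y) ^ k / (1 + a n * y)) -
        (a n * y) ^ (k + 1) / (1 + a n * y) ^ 2| ≤
        (k + 1) * ((a n * R) ^ k * 2) + (a n * R) ^ (k + 1) * 2 ^ 2 := by
      refine (abs_sub _ _).trans (add_le_add ?_ h2)
      rw [abs_mul, abs_of_pos (show (0 : ℝ) < k + 1 by positivity)]
      exact mul_le_mul_of_nonneg_left h1 (by positivity)
    calc _ ≤ ((k + 1) * ((a n * R) ^ k * 2) + (a n * R) ^ (k + 1) * 2 ^ 2) * a n :=
          mul_le_mul_of_nonneg_right h3 (ha0 n).le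
      _ = a n ^ (k + 1) * ((k + 1) * (R ^ k * 2)) + a n ^ (k + 1) * a n * (R ^ (k + 1) * 4) := by
          rw [mul_pow, mul_pow]; ring
      _ ≤ a n ^ (k + 1) * ((k + 1) * (R ^ k * 2)) + a n ^ (k + 1) * 1 * (R ^ (k + 1) * 4) := by
          gcongr
          exact ha1 n
      _ = _ := by ring
  · simp [summable_zero]

/-- For a canonical product `G` of genus `k` with zeros `-1 / a n`, the function `x (x G' / G)'`
is a sum of values of one elementary function. -/
lemma mul_derivXLogDeriv_eq {G : ℝ → ℝ} (ha0 : ∀ n, 0 < a n) (ha1 : ∀ n, a n ≤ 1)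
    (hsum : Summable fun n => a n ^ (k + 1))
    (hG : ∀ x, 0 < x → G x = ∏' n, Real.exp (logElementaryFactor k (a n * x))) {x : ℝ}
    (hx : 0 < x) :
    0 < G x ∧ x * derivXLogDeriv G x = (-1) ^ k * ∑' n, eulerTerm k (a n * x) := by
  have hR : 1 ≤ x + 1 := by linarith
  have hGexp : ∀ y ∈ Ioo 0 (x + 1), G y = Real.exp (∑' n, logElementaryFactor k (a n * y)) := by
    intro y hy
    rw [hG y hy.1]
    exact (summable_logElementaryFactor_and_hasDerivAt_tsum ha0 ha1 hsum hR
      (y := y) ⟨by linarith [hy.1], hy.2⟩).1.hasSum.rexp.tprod_eq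
  have hGder : ∀ y ∈ Ioo 0 (x + 1), y * deriv G y / G y =
      ∑' n, a n * y * ((-(a n * y)) ^ k / (1 + a n * y)) := by
    intro y hy
    have h1 := (summable_logElementaryFactor_and_hasDerivAt_tsum ha0 ha1 hsum hR
      (y := y) ⟨by linarith [hy.1], hy.2⟩).2.exp
    have h2 : HasDerivAt G _ y := h1.congr_of_eventuallyEq
      (Filter.eventually_of_mem (isOpen_Ioo.mem_nhds hy) hGexp)
    rw [h2.deriv, hGexp y hy, mul_left_comm, mul_div_cancel_left₀ _ (Real.exp_pos _).ne',
      ← tsum_mul_left]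
    exact tsum_congr fun n => by ring
  have hxm : x ∈ Ioo 0 (x + 1) := ⟨hx, by linarith⟩
  refine ⟨by rw [hGexp x hxm]; exact Real.exp_pos _, ?_⟩
  have h3 : derivXLogDeriv G x = _ := (Filter.EventuallyEq.deriv_eq
    (Filter.eventually_of_mem (isOpen_Ioo.mem_nhds hxm) hGder)).trans
      (hasDerivAt_tsum_mul_pow_div ha0 ha1 hsum hR ⟨by linarith, by linarith⟩).deriv
  rw [h3, ← tsum_mul_left, ← tsum_mul_left]
  refine tsum_congr fun n => ?_
  rw [eulerTerm]
  ring

end CanonicalProduct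

/-! ### The multiplicative period group attached to the product with geometric zeros -/

section PeriodGroup

open Set Filter Topology

/-- The sum `∑ w / (1 + w) ^ 2` over `w = b ^ (n + 1) * x`, `n ≥ 0`. -/
noncomputable def halfThetaSum (b x : ℝ) : ℝ :=
  ∑' n : ℕ, b ^ (n + 1) * x / (1 + b ^ (n + 1) * x) ^ 2

/-- The sum `∑ w / (1 + w) ^ 2` over all `w = b ^ n * x`, `n ∈ ℤ`; the terms with `n < 0` are
written with `w⁻¹` in place of `w`, which does not change `w / (1 + w) ^ 2`. -/
noncomputable def thetaSum (b x : ℝ) : ℝ :=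
  x / (1 + x) ^ 2 + halfThetaSum b x + halfThetaSum b x⁻¹

variable {b : ℝ}

lemma div_one_add_sq_nonneg {w : ℝ} (hw : 0 ≤ w) : 0 ≤ w / (1 + w) ^ 2 := by positivity

lemma div_one_add_sq_le {w : ℝ} (hw : 0 ≤ w) : w / (1 + w) ^ 2 ≤ w :=
  div_le_self hw (by nlinarith)

lemma inv_div_one_add_inv_sq {w : ℝ} (hw : 0 < w) : w⁻¹ / (1 + w⁻¹) ^ 2 = w / (1 + w) ^ 2 := by
  field_simp
  ring

lemma summable_halfThetaSum (hb0 : 0 < b) (hb1 : b < 1) {x : ℝ} (hx : 0 ≤ x) :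
    Summable fun n : ℕ => b ^ (n + 1) * x / (1 + b ^ (n + 1) * x) ^ 2 :=
  Summable.of_nonneg_of_le (fun n => div_one_add_sq_nonneg (by positivity))
    (fun n => div_one_add_sq_le (by positivity))
    (((summable_nat_add_iff 1).2 (summable_geometric_of_lt_one hb0.le hb1)).mul_right x)

lemma halfThetaSum_eq_add (hb0 : 0 < b) (hb1 : b < 1) {x : ℝ} (hx : 0 ≤ x) :
    halfThetaSum b (b⁻¹ * x) = x / (1 + x) ^ 2 + halfThetaSum b x := by
  have h : ∀ n : ℕ, b ^ (n + 1) * (b⁻¹ * x) = b ^ n * x := fun n => by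
    field_simp
    ring
  have hs := summable_halfThetaSum hb0 hb1 (x := b⁻¹ * x) (by positivity)
  rw [halfThetaSum, hs.tsum_eq_zero_add]
  simp only [h, pow_zero, one_mul, halfThetaSum]

lemma thetaSum_inv_mul (hb0 : 0 < b) (hb1 : b < 1) {x : ℝ} (hx : 0 < x) :
    thetaSum b (b⁻¹ * x) = thetaSum b x := by
  have h1 := halfThetaSum_eq_add hb0 hb1 hx.le
  have h2 := halfThetaSum_eq_add hb0 hb1 (x := (b⁻¹ * x)⁻¹) (by positivity)
  rw [inv_div_one_add_inv_sq (by positivity)] at h2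
  rw [show b⁻¹ * (b⁻¹ * x)⁻¹ = x⁻¹ by field_simp] at h2
  rw [thetaSum, thetaSum, h1, h2]
  ring

lemma thetaSum_inv_pow_mul (hb0 : 0 < b) (hb1 : b < 1) {x : ℝ} (hx : 0 < x) (m : ℕ) :
    thetaSum b (b⁻¹ ^ m * x) = thetaSum b x := by
  induction m with
  | zero => simp
  | succ m ih => rw [pow_succ', mul_assoc, thetaSum_inv_mul hb0 hb1 (by positivity), ih]

lemma tendsto_thetaSum_sub_halfThetaSum (hb0 : 0 < b) (hb1 : b < 1) :
    Tendsto (fun x => thetaSum b x - halfThetaSum b x) atTop (𝓝 0) := by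
  have h0 : Tendsto (fun x : ℝ => x⁻¹ + (∑' n : ℕ, b ^ (n + 1)) * x⁻¹) atTop (𝓝 0) := by
    simpa using tendsto_inv_atTop_zero.add
      ((tendsto_inv_atTop_zero (𝕜 := ℝ)).const_mul (∑' n : ℕ, b ^ (n + 1)))
  refine squeeze_zero' ?_ ?_ h0
  · filter_upwards [eventually_gt_atTop 0] with x hx
    have h1 : 0 ≤ halfThetaSum b x⁻¹ :=
      tsum_nonneg fun n => div_one_add_sq_nonneg (by positivity)
    have h2 := div_one_add_sq_nonneg hx.le
    rw [thetaSum]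
    linarith
  · filter_upwards [eventually_gt_atTop 0] with x hx
    have hx' : 0 < x⁻¹ := inv_pos.2 hx
    have h1 : halfThetaSum b x⁻¹ ≤ (∑' n : ℕ, b ^ (n + 1)) * x⁻¹ := by
      rw [← tsum_mul_right]
      exact (summable_halfThetaSum hb0 hb1 hx'.le).tsum_le_tsum
        (fun n => div_one_add_sq_le (by positivity))
        (((summable_nat_add_iff 1).2 (summable_geometric_of_lt_one hb0.le hb1)).mul_right _)
    have h2 := div_one_add_sq_le hx'.le
    rw [inv_div_one_add_inv_sq hx] at h2
    rw [thetaSum]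
    linarith

/-- The asymptotic multiplicative periods of `halfThetaSum` are the exact ones of `thetaSum`. -/
lemma tendsto_halfThetaSum_sub_iff (hb0 : 0 < b) (hb1 : b < 1) {y : ℝ} (hy : 0 < y) :
    Tendsto (fun x => halfThetaSum b (x * y) - halfThetaSum b x) atTop (𝓝 0) ↔
      ∀ x, 0 < x → thetaSum b (x * y) = thetaSum b x := by
  have hlim := tendsto_thetaSum_sub_halfThetaSum hb0 hb1
  have hlimy := hlim.comp (tendsto_id.atTop_mul_const hy)
  constructor
  · intro h x hx
    have h1 : Tendsto (fun x => thetaSum b (x * y) - thetaSum b x) atTop (𝓝 0) := by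
      have := (hlimy.sub hlim).add h
      rw [sub_zero, add_zero] at this
      refine this.congr fun x => ?_
      simp only [Function.comp_apply, id]
      ring
    have h2 : Tendsto (fun m : ℕ => b⁻¹ ^ m * x) atTop atTop :=
      (tendsto_pow_atTop_atTop_of_one_lt ((one_lt_inv₀ hb0).2 hb1)).atTop_mul_const hx
    have h3 := (h1.comp h2).congr (f₂ := fun _ => thetaSum b (x * y) - thetaSum b x) fun m => by
      simp only [Function.comp_apply]
      rw [mul_assoc, thetaSum_inv_pow_mul hb0 hb1 (mul_pos hx hy), thetaSum_inv_pow_mul hb0 hb1 hx]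
    exact sub_eq_zero.1 (tendsto_nhds_unique tendsto_const_nhds h3)
  · intro h
    have := hlim.sub hlimy
    rw [sub_zero] at this
    refine this.congr' ?_
    filter_upwards [eventually_gt_atTop 0] with x hx
    simp only [Function.comp_apply, id, h x hx]
    ring

/-- The complexification of `t ↦ halfThetaSum b (exp t)`. -/
noncomputable def halfThetaSumExp (b : ℝ) (w : ℂ) : ℂ :=
  ∑' n : ℕ, (b : ℂ) ^ (n + 1) * Complex.exp w / (1 + (b : ℂ) ^ (n + 1) * Complex.exp w) ^ 2

lemma halfThetaSumExp_ofReal (b t : ℝ) :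
    halfThetaSumExp b t = (halfThetaSum b (Real.exp t) : ℂ) := by
  rw [halfThetaSumExp, halfThetaSum, Complex.ofReal_tsum]
  exact tsum_congr fun n => by push_cast; rfl

/-- With `b = exp (-2 δ)` and `|Re w| < δ`, each `b ^ (n + 1) * exp w` has norm at most
`exp (-δ) < 1`, so that no term has a pole in the strip. -/
lemma differentiableOn_halfThetaSumExp {δ : ℝ} (hδ : 0 < δ) :
    DifferentiableOn ℂ (halfThetaSumExp (Real.exp (-(2 * δ)))) {w : ℂ | |w.re| < δ} := by
  obtain ⟨b, hb⟩ : ∃ b : ℝ, b = Real.exp (-(2 * δ)) := ⟨_, rfl⟩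
  rw [← hb]
  have hb0 : 0 < b := hb ▸ Real.exp_pos _
  have hb1 : b < 1 := by rw [hb]; exact Real.exp_lt_one_iff.2 (by linarith)
  have hq1 : Real.exp (-δ) < 1 := Real.exp_lt_one_iff.2 (by linarith)
  have hU : IsOpen {w : ℂ | |w.re| < δ} :=
    isOpen_lt (Complex.continuous_re.abs) continuous_const
  have hnorm : ∀ (n : ℕ) (w : ℂ), |w.re| < δ →
      ‖(b : ℂ) ^ (n + 1) * Complex.exp w‖ ≤ b ^ n * Real.exp (-δ) := by
    intro n w hw
    rw [norm_mul, norm_pow, Complex.norm_real, Complex.norm_exp, Real.norm_eq_abs, abs_of_pos hb0,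
      pow_succ, mul_assoc]
    refine mul_le_mul_of_nonneg_left ?_ (by positivity)
    rw [hb, ← Real.exp_add]
    exact Real.exp_le_exp.2 (by linarith [(abs_lt.1 hw).2])
  have hle : ∀ (n : ℕ) (w : ℂ), |w.re| < δ →
      1 - Real.exp (-δ) ≤ ‖1 + (b : ℂ) ^ (n + 1) * Complex.exp w‖ := by
    intro n w hw
    have h1 := hnorm n w hw
    have h2 : b ^ n * Real.exp (-δ) ≤ Real.exp (-δ) :=
      mul_le_of_le_one_left (Real.exp_pos _).le (pow_le_one₀ hb0.le hb1.le)
    have h3 := norm_sub_norm_le (1 : ℂ) (-((b : ℂ) ^ (n + 1) * Complex.exp w))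
    rw [sub_neg_eq_add, norm_neg, norm_one] at h3
    linarith
  have hpos : 0 < 1 - Real.exp (-δ) := by linarith
  refine Complex.differentiableOn_tsum_of_summable_norm
    (u := fun n => b ^ n * (Real.exp (-δ) / (1 - Real.exp (-δ)) ^ 2))
    ((summable_geometric_of_lt_one hb0.le hb1).mul_right _) (fun n w hw => ?_) hU
    fun n w hw => ?_
  · have hne : 1 + (b : ℂ) ^ (n + 1) * Complex.exp w ≠ 0 :=
      norm_pos_iff.1 (hpos.trans_le (hle n w hw))
    have hd : DifferentiableAt ℂ (fun w => (b : ℂ) ^ (n + 1) * Complex.exp w) w := by fun_prop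
    exact (hd.div ((hd.const_add 1).pow 2) (pow_ne_zero 2 hne)).differentiableWithinAt
  · rw [norm_div, norm_pow, ← mul_div_assoc]
    exact div_le_div₀ (by positivity) (hnorm n w hw) (by positivity)
      (pow_le_pow_left₀ hpos.le (hle n w hw) 2)

/-- The function `t ↦ thetaSum b (exp t)` takes no value at points accumulating at `0`: otherwise
its analytic continuation along the imaginary axis would be constant, in contradiction with the
pole at `π * I`. -/
lemma not_frequently_thetaSum_exp_eq {δ : ℝ} (hδ : 0 < δ) (C : ℝ) :
    ¬ ∃ᶠ t : ℝ in 𝓝[≠] 0, thetaSum (Real.exp (-(2 * δ))) (Real.exp t) = C := by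
  intro hfreq
  obtain ⟨b, hb⟩ : ∃ b : ℝ, b = Real.exp (-(2 * δ)) := ⟨_, rfl⟩
  have hU : IsOpen {w : ℂ | |w.re| < δ} :=
    isOpen_lt (Complex.continuous_re.abs) continuous_const
  have hconv : Convex ℝ {w : ℂ | |w.re| < δ} := by
    have : {w : ℂ | |w.re| < δ} = Complex.reLm ⁻¹' Ioo (-δ) δ := by
      ext w
      simp [abs_lt]
    rw [this]
    exact (convex_Ioo _ _).linear_preimage _
  have hd := differentiableOn_halfThetaSumExp hδ
  rw [← hb] at hd hfreq
  have hd' : DifferentiableOn ℂ (fun w => halfThetaSumExp b (-w)) {w : ℂ | |w.re| < δ} :=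
    hd.comp differentiable_neg.differentiableOn fun w hw => by
      simpa using hw
  -- multiplying by `(1 + exp w) ^ 2` removes the poles of the term `exp w / (1 + exp w) ^ 2`
  have hF : DifferentiableOn ℂ (fun w => (1 + Complex.exp w) ^ 2 *
      (C - halfThetaSumExp b w - halfThetaSumExp b (-w)) - Complex.exp w)
      {w : ℂ | |w.re| < δ} := by
    have he : DifferentiableOn ℂ Complex.exp {w : ℂ | |w.re| < δ} :=
      Complex.differentiable_exp.differentiableOn
    exact (((he.const_add 1).pow 2).mul (((differentiableOn_const _).sub hd).sub hd')).sub he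
  have hzero := (hF.analyticOnNhd hU).eqOn_zero_of_preconnected_of_frequently_eq_zero
    hconv.isPreconnected (z₀ := 0) (by simpa using hδ) (by
      have hmap : Tendsto (fun t : ℝ => (t : ℂ)) (𝓝[≠] 0) (𝓝[≠] 0) := by
        refine tendsto_nhdsWithin_iff.2 ⟨?_, ?_⟩
        · exact (Complex.continuous_ofReal.tendsto' 0 0 (by simp)).mono_left nhdsWithin_le_nhds
        · filter_upwards [self_mem_nhdsWithin] with t ht
          simpa using ht
      refine hmap.frequently (hfreq.mono fun t ht => ?_)
      rw [thetaSum] at ht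
      have h1 : (1 : ℝ) + Real.exp t ≠ 0 := by positivity
      have h2 : (1 + Real.exp t) ^ 2 * (C - halfThetaSum b (Real.exp t) -
          halfThetaSum b (Real.exp (-t))) - Real.exp t = 0 := by
        rw [← ht, Real.exp_neg]
        field_simp
        ring
      rw [← Complex.ofReal_neg, halfThetaSumExp_ofReal, halfThetaSumExp_ofReal]
      exact_mod_cast congrArg (fun r : ℝ => (r : ℂ)) h2)
  have hpi := hzero (x := Real.pi * Complex.I) (by simpa using hδ)
  simp [Complex.exp_pi_mul_I] at hpi

/-- The asymptotic multiplicative periods of `halfThetaSum` form an infinite cyclic group. -/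
theorem exists_generator_periods (hb0 : 0 < b) (hb1 : b < 1) :
    ∃ γ : ℝ, 1 < γ ∧ ∀ y : ℝ, 0 < y →
      (Tendsto (fun x => halfThetaSum b (x * y) - halfThetaSum b x) atTop (𝓝 0) ↔
        ∃ n : ℤ, y = γ ^ n) := by
  let A : AddSubgroup ℝ :=
    { carrier := {t | ∀ x, 0 < x → thetaSum b (x * Real.exp t) = thetaSum b x}
      zero_mem' := fun x _ => by simp
      add_mem' := fun {s t} hs ht x hx => by
        rw [Real.exp_add, ← mul_assoc, ht _ (mul_pos hx (Real.exp_pos s)), hs x hx]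
      neg_mem' := fun {t} ht x hx => by
        have := ht (x * Real.exp (-t)) (mul_pos hx (Real.exp_pos _))
        rw [mul_assoc, ← Real.exp_add, neg_add_cancel, Real.exp_zero, mul_one] at this
        exact this.symm }
  have hA : ∀ t, t ∈ A ↔ ∀ x, 0 < x → thetaSum b (x * Real.exp t) = thetaSum b x :=
    fun t => Iff.rfl
  have hlog : Real.log b < 0 := Real.log_neg hb0 hb1
  have hmem : -Real.log b ∈ A := by
    intro x hx
    rw [Real.exp_neg, Real.exp_log hb0, mul_comm]
    exact thetaSum_inv_mul hb0 hb1 hx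
  rcases AddSubgroup.dense_or_cyclic A with hdense | ⟨a, ha⟩
  · exfalso
    have hδ : 0 < -Real.log b / 2 := by linarith
    refine not_frequently_thetaSum_exp_eq hδ (thetaSum b 1) ?_
    rw [show -(2 * (-Real.log b / 2)) = Real.log b by ring, Real.exp_log hb0]
    have h1 : (0 : ℝ) ∈ closure ((A : Set ℝ) \ {0}) :=
      (hdense.sdiff_singleton 0) 0
    rw [mem_closure_iff_frequently] at h1
    rw [frequently_nhdsWithin_iff]
    refine h1.mono fun t ht => ⟨?_, ht.2⟩
    have := (hA t).1 ht.1 1 one_pos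
    rwa [one_mul] at this
  · have hmemA : ∀ t, t ∈ A ↔ ∃ n : ℤ, t = n * a := by
      intro t
      rw [ha, AddSubgroup.mem_closure_singleton]
      simp [eq_comm]
    have ha0 : a ≠ 0 := by
      rintro rfl
      obtain ⟨n, hn⟩ := (hmemA _).1 hmem
      rw [mul_zero] at hn
      linarith
    refine ⟨Real.exp |a|, Real.one_lt_exp_iff.2 (abs_pos.2 ha0), fun y hy => ?_⟩
    rw [tendsto_halfThetaSum_sub_iff hb0 hb1 hy]
    have h1 := hmemA (Real.log y)
    rw [hA, Real.exp_log hy] at h1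
    rw [h1]
    have h2 : ∀ n : ℤ, y = Real.exp |a| ^ n ↔ Real.log y = n * |a| := by
      intro n
      rw [← Real.rpow_intCast, ← Real.exp_mul, mul_comm]
      constructor
      · rintro rfl
        rw [Real.log_exp]
      · intro h
        rw [← h, Real.exp_log hy]
    simp only [h2]
    rcases abs_choice a with h | h
    · rw [h]
    · rw [h]
      constructor
      · rintro ⟨n, hn⟩
        exact ⟨-n, by rw [hn]; push_cast; ring⟩
      · rintro ⟨n, hn⟩
        exact ⟨-n, by rw [hn]; push_cast; ring⟩

end PeriodGroup

/-! ### Riemann sums of decreasing functions and the asymptotics of canonical products -/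

section RiemannSums

open Set Filter Topology MeasureTheory

variable {h : ℝ → ℝ}

lemma intervalIntegrable_of_integrableOn_Ioi (hi : IntegrableOn h (Ioi 0)) {a b : ℝ} (ha : 0 ≤ a)
    (hab : a ≤ b) : IntervalIntegrable h volume a b :=
  (intervalIntegrable_iff_integrableOn_Ioc_of_le hab).2
    (hi.mono_set fun _ hx => ha.trans_lt hx.1)

lemma AntitoneOn.mul_le_integral (ha : AntitoneOn h (Ioi 0)) (hi : IntegrableOn h (Ioi 0))
    {a ε : ℝ} (ha0 : 0 ≤ a) (hε : 0 < ε) : ε * h (a + ε) ≤ ∫ x in a..a + ε, h x := by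
  have h1 : ∫ _ in a..a + ε, h (a + ε) ≤ ∫ x in a..a + ε, h x :=
    intervalIntegral.integral_mono_on_of_le_Ioo (by linarith) (by simp)
      (intervalIntegrable_of_integrableOn_Ioi hi ha0 (by linarith)) fun x hx =>
        ha (ha0.trans_lt hx.1) (show 0 < a + ε by linarith) hx.2.le
  rwa [intervalIntegral.integral_const, add_sub_cancel_left, smul_eq_mul] at h1

lemma AntitoneOn.integral_le_mul (ha : AntitoneOn h (Ioi 0)) (hi : IntegrableOn h (Ioi 0))
    {a ε : ℝ} (ha0 : 0 < a) (hε : 0 < ε) : ∫ x in a..a + ε, h x ≤ ε * h a := by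
  have h1 : ∫ x in a..a + ε, h x ≤ ∫ _ in a..a + ε, h a :=
    intervalIntegral.integral_mono_on_of_le_Ioo (by linarith)
      (intervalIntegrable_of_integrableOn_Ioi hi ha0.le (by linarith)) (by simp) fun x hx =>
        ha ha0 (ha0.trans hx.1) hx.1.le
  rwa [intervalIntegral.integral_const, add_sub_cancel_left, smul_eq_mul] at h1

lemma AntitoneOn.summable_and_tsum_mem_Icc (ha : AntitoneOn h (Ioi 0))
    (hi : IntegrableOn h (Ioi 0)) (h0 : ∀ x, 0 < x → 0 ≤ h x) {ε : ℝ} (hε : 0 < ε) :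
    Summable (fun n : ℕ => ε * h ((n + 1) * ε)) ∧
      ∑' n : ℕ, ε * h ((n + 1) * ε) ∈ Icc (∫ x in Ioi ε, h x) (∫ x in Ioi 0, h x) := by
  have hnn : ∀ n : ℕ, 0 ≤ ε * h ((n + 1) * ε) := fun n =>
    mul_nonneg hε.le (h0 _ (by positivity))
  have hle : ∀ N : ℕ, ∑ n ∈ Finset.range N, ε * h ((n + 1) * ε) ≤ ∫ x in Ioi 0, h x := by
    intro N
    calc ∑ n ∈ Finset.range N, ε * h ((n + 1) * ε)
        ≤ ∑ n ∈ Finset.range N, ∫ x in ((n : ℕ) : ℝ) * ε..((n + 1 : ℕ) : ℝ) * ε, h x := by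
          refine Finset.sum_le_sum fun n _ => ?_
          have := ha.mul_le_integral hi (a := n * ε) (by positivity) hε
          rw [show (n : ℝ) * ε + ε = (n + 1) * ε by ring] at this
          exact_mod_cast this
      _ = ∫ x in ((0 : ℕ) : ℝ) * ε..(N : ℝ) * ε, h x :=
          intervalIntegral.sum_integral_adjacent_intervals (a := fun n : ℕ => (n : ℝ) * ε)
            fun n _ => intervalIntegrable_of_integrableOn_Ioi hi (by positivity)
              (by push_cast; nlinarith)
      _ = ∫ x in Ioc 0 ((N : ℝ) * ε), h x := by
          rw [Nat.cast_zero, zero_mul, intervalIntegral.integral_of_le (by positivity)]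
      _ ≤ ∫ x in Ioi 0, h x :=
          setIntegral_mono_set hi ((ae_restrict_iff' measurableSet_Ioi).2
            (Eventually.of_forall fun x hx => h0 x hx)) Ioc_subset_Ioi_self.eventuallyLE
  have hs := summable_of_sum_range_le hnn hle
  refine ⟨hs, ?_, Real.tsum_le_of_sum_range_le hnn hle⟩
  have hN : Tendsto (fun N : ℕ => ((N + 1 : ℕ) : ℝ) * ε) atTop atTop :=
    ((tendsto_add_atTop_iff_nat 1).2 tendsto_natCast_atTop_atTop).atTop_mul_const hε
  refine le_of_tendsto' (intervalIntegral_tendsto_integral_Ioi ε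
    (hi.mono_set (Ioi_subset_Ioi hε.le)) hN) fun N => ?_
  calc ∫ x in ε..((N + 1 : ℕ) : ℝ) * ε, h x
      = ∫ x in ((0 + 1 : ℕ) : ℝ) * ε..((N + 1 : ℕ) : ℝ) * ε, h x := by simp
    _ = ∑ n ∈ Finset.range N, ∫ x in ((n + 1 : ℕ) : ℝ) * ε..((n + 1 + 1 : ℕ) : ℝ) * ε, h x :=
        (intervalIntegral.sum_integral_adjacent_intervals
          (a := fun n : ℕ => ((n + 1 : ℕ) : ℝ) * ε)
          fun n _ => intervalIntegrable_of_integrableOn_Ioi hi (by positivity)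
            (by push_cast; nlinarith)).symm
    _ ≤ ∑ n ∈ Finset.range N, ε * h ((n + 1) * ε) := by
        refine Finset.sum_le_sum fun n _ => ?_
        have := ha.integral_le_mul hi (a := (n + 1) * ε) (by positivity) hε
        rw [show ((n : ℝ) + 1) * ε + ε = (n + 1 + 1) * ε by ring] at this
        exact_mod_cast this
    _ ≤ _ := hs.sum_le_tsum _ fun n _ => hnn n

/-- Riemann sums of a decreasing integrable function on `(0, ∞)` converge to its integral. -/
lemma AntitoneOn.tendsto_tsum_mul (ha : AntitoneOn h (Ioi 0))
    (hi : IntegrableOn h (Ioi 0)) (h0 : ∀ x, 0 < x → 0 ≤ h x) :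
    Tendsto (fun ε => ∑' n : ℕ, ε * h ((n + 1) * ε)) (𝓝[>] 0) (𝓝 (∫ x in Ioi 0, h x)) := by
  have hprim : Tendsto (fun ε => ∫ x in Ioc 0 ε, h x) (𝓝[>] 0) (𝓝 0) := by
    have hc := intervalIntegral.continuousOn_primitive (f := h) (a := 0) (b := 1) (μ := volume)
      ((integrableOn_Icc_iff_integrableOn_Ioc (by simp)).2 (hi.mono_set Ioc_subset_Ioi_self))
    have := (hc 0 (by simp)).tendsto
    rw [Ioc_self, setIntegral_empty] at this
    refine this.mono_left ?_
    rw [← nhdsWithin_Ioo_eq_nhdsGT (zero_lt_one (α := ℝ))]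
    exact nhdsWithin_mono _ Ioo_subset_Icc_self
  have hlow : Tendsto (fun ε => ∫ x in Ioi ε, h x) (𝓝[>] 0) (𝓝 (∫ x in Ioi 0, h x)) := by
    have := (tendsto_const_nhds (x := ∫ x in Ioi 0, h x)).sub hprim
    rw [sub_zero] at this
    refine this.congr' ?_
    filter_upwards [self_mem_nhdsWithin] with ε hε
    have hε : (0 : ℝ) < ε := hε
    rw [← Ioc_union_Ioi_eq_Ioi hε.le, setIntegral_union Ioc_disjoint_Ioi_same measurableSet_Ioi
      (hi.mono_set Ioc_subset_Ioi_self) (hi.mono_set (Ioi_subset_Ioi hε.le)), add_sub_cancel_left]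
  refine tendsto_of_tendsto_of_tendsto_of_le_of_le' hlow tendsto_const_nhds ?_ ?_ <;>
  · filter_upwards [self_mem_nhdsWithin] with ε hε
    first
    | exact (ha.summable_and_tsum_mem_Icc hi h0 hε).2.1
    | exact (ha.summable_and_tsum_mem_Icc hi h0 hε).2.2

/-- A nonnegative increasing function of order between `w ^ p` and `w ^ q`. Under the substitution
`w = u ^ (-s)` with `p * s < 1 < q * s` it becomes decreasing and integrable on `(0, ∞)`. -/
structure MonotoneBetweenPowers (E : ℝ → ℝ) (p q : ℕ) : Prop where
  mono : MonotoneOn E (Ioi 0)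
  nonneg : ∀ w, 0 < w → 0 ≤ E w
  le_pow_left : ∃ C, ∀ w, 0 < w → E w ≤ C * w ^ p
  le_pow_right : ∃ C, ∀ w, 0 < w → E w ≤ C * w ^ q

namespace MonotoneBetweenPowers

variable {E : ℝ → ℝ} {p q : ℕ} {s : ℝ}

lemma antitoneOn (hE : MonotoneBetweenPowers E p q) (hs : 0 < s) :
    AntitoneOn (fun u : ℝ => E (u ^ (-s))) (Ioi 0) := by
  intro u hu v hv huv
  exact hE.mono (Real.rpow_pos_of_pos hv _) (Real.rpow_pos_of_pos hu _)
    (Real.rpow_le_rpow_of_nonpos hu huv (by linarith))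

lemma integrableOn (hE : MonotoneBetweenPowers E p q) (hs : 0 < s) (hp : p * s < 1)
    (hq : 1 < q * s) : IntegrableOn (fun u : ℝ => E (u ^ (-s))) (Ioi 0) := by
  have hmeas := aemeasurable_restrict_of_antitoneOn (μ := volume) measurableSet_Ioi
    (hE.antitoneOn hs)
  have hpow : ∀ (i : ℕ) (u : ℝ), 0 < u → (u ^ (-s)) ^ i = u ^ (-(i * s)) := by
    intro i u hu
    rw [← Real.rpow_mul_natCast hu.le]
    congr 1
    ring
  rw [← Ioc_union_Ioi_eq_Ioi (zero_le_one (α := ℝ))]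
  refine IntegrableOn.union ?_ ?_
  · obtain ⟨C, hC⟩ := hE.le_pow_left
    have h1 : IntegrableOn (fun u : ℝ => C * u ^ (-(p * s))) (Ioc 0 1) :=
      ((intervalIntegrable_iff_integrableOn_Ioc_of_le zero_le_one).1
        (intervalIntegral.intervalIntegrable_rpow' (by linarith))).const_mul C
    refine h1.mono' (hmeas.mono_measure (Measure.restrict_mono Ioc_subset_Ioi_self le_rfl)
      ).aestronglyMeasurable ((ae_restrict_iff' measurableSet_Ioc).2
        (Eventually.of_forall fun u hu => ?_))
    have hu' := Real.rpow_pos_of_pos hu.1 (-s)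
    rw [Real.norm_of_nonneg (hE.nonneg _ hu'), ← hpow p u hu.1]
    exact hC _ hu'
  · obtain ⟨C, hC⟩ := hE.le_pow_right
    have h1 : IntegrableOn (fun u : ℝ => C * u ^ (-(q * s))) (Ioi 1) :=
      (integrableOn_Ioi_rpow_of_lt (by linarith) one_pos).const_mul C
    refine h1.mono' (hmeas.mono_measure (Measure.restrict_mono (Ioi_subset_Ioi zero_le_one) le_rfl)
      ).aestronglyMeasurable ((ae_restrict_iff' measurableSet_Ioi).2
        (Eventually.of_forall fun u hu => ?_))
    have hu0 : (0 : ℝ) < u := one_pos.trans hu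
    have hu' := Real.rpow_pos_of_pos hu0 (-s)
    rw [Real.norm_of_nonneg (hE.nonneg _ hu'), ← hpow q u hu0]
    exact hC _ hu'

lemma rpow_substitution (hs : 0 < s) {x : ℝ} (hx : 0 < x) (n : ℕ) :
    (((n : ℝ) + 1) * x ^ (-(1 / s))) ^ (-s) = (((n : ℝ) + 1) ^ s)⁻¹ * x := by
  rw [Real.mul_rpow (by positivity) (by positivity), Real.rpow_neg (by positivity),
    ← Real.rpow_mul hx.le, show -(1 / s) * -s = 1 by field_simp, Real.rpow_one]

lemma summable (hE : MonotoneBetweenPowers E p q) (hs : 0 < s) (hp : p * s < 1)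
    (hq : 1 < q * s) {x : ℝ} (hx : 0 < x) :
    Summable fun n : ℕ => E ((((n : ℝ) + 1) ^ s)⁻¹ * x) := by
  have hε : 0 < x ^ (-(1 / s)) := Real.rpow_pos_of_pos hx _
  have := ((hE.antitoneOn hs).summable_and_tsum_mem_Icc (hE.integrableOn hs hp hq)
    (fun u hu => hE.nonneg _ (Real.rpow_pos_of_pos hu _)) hε).1
  rw [summable_mul_left_iff hε.ne'] at this
  exact this.congr fun n => by rw [rpow_substitution hs hx]

lemma tendsto (hE : MonotoneBetweenPowers E p q) (hs : 0 < s) (hp : p * s < 1)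
    (hq : 1 < q * s) :
    Tendsto (fun x : ℝ => x ^ (-(1 / s)) * ∑' n : ℕ, E ((((n : ℝ) + 1) ^ s)⁻¹ * x)) atTop
      (𝓝 (∫ u in Ioi (0 : ℝ), E (u ^ (-s)))) := by
  have h1 : Tendsto (fun x : ℝ => x ^ (-(1 / s))) atTop (𝓝[>] 0) := by
    refine tendsto_nhdsWithin_iff.2 ⟨tendsto_rpow_neg_atTop (by positivity), ?_⟩
    filter_upwards [eventually_gt_atTop 0] with x hx using Real.rpow_pos_of_pos hx _
  have h2 := ((hE.antitoneOn hs).tendsto_tsum_mul (hE.integrableOn hs hp hq)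
    (fun u hu => hE.nonneg _ (Real.rpow_pos_of_pos hu _))).comp h1
  refine h2.congr' ?_
  filter_upwards [eventually_gt_atTop 0] with x hx
  simp only [Function.comp_apply]
  rw [← tsum_mul_left]
  exact tsum_congr fun n => by rw [rpow_substitution hs hx]

end MonotoneBetweenPowers

/-- The sum over `n ≥ 1` of a positive combination `c * E₁ - E₂` at `x / n ^ s` is asymptotic to a
positive multiple of `x ^ (1 / s)`. -/
lemma exists_pos_tendsto_tsum_sub {E₁ E₂ : ℝ → ℝ} {p q : ℕ} {s : ℝ} (c : ℝ)
    (h₁ : MonotoneBetweenPowers E₁ p q) (h₂ : MonotoneBetweenPowers E₂ p q) (hs : 0 < s)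
    (hp : p * s < 1) (hq : 1 < q * s) (hpos : ∀ w, 0 < w → 0 < c * E₁ w - E₂ w) :
    ∃ I : ℝ, 0 < I ∧
      Tendsto (fun x : ℝ => x ^ (-(1 / s)) *
        ∑' n : ℕ, (c * E₁ ((((n : ℝ) + 1) ^ s)⁻¹ * x) - E₂ ((((n : ℝ) + 1) ^ s)⁻¹ * x))) atTop
        (𝓝 I) := by
  have hi₁ := (h₁.integrableOn hs hp hq).const_mul c
  have hi₂ := h₂.integrableOn hs hp hq
  refine ⟨∫ u in Ioi (0 : ℝ), (c * E₁ (u ^ (-s)) - E₂ (u ^ (-s))), ?_, ?_⟩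
  · have hpos' : ∀ u ∈ Ioi (0 : ℝ), 0 < c * E₁ (u ^ (-s)) - E₂ (u ^ (-s)) :=
      fun u hu => hpos _ (Real.rpow_pos_of_pos hu _)
    rw [setIntegral_pos_iff_support_of_nonneg_ae ((ae_restrict_iff' measurableSet_Ioi).2
      (Eventually.of_forall fun u hu => (hpos' u hu).le)) (hi₁.sub hi₂)]
    have hsupp : Ioi (0 : ℝ) ⊆ Function.support fun u => c * E₁ (u ^ (-s)) - E₂ (u ^ (-s)) :=
      fun u hu => (hpos' u hu).ne'
    rw [inter_eq_right.2 hsupp, Real.volume_Ioi]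
    exact ENNReal.zero_lt_top
  · rw [integral_sub hi₁ hi₂, integral_const_mul]
    refine (((h₁.tendsto hs hp hq).const_mul c).sub (h₂.tendsto hs hp hq)).congr' ?_
    filter_upwards [eventually_gt_atTop 0] with x hx
    rw [((h₁.summable hs hp hq hx).mul_left c).tsum_sub (h₂.summable hs hp hq hx), tsum_mul_left]
    ring

end RiemannSums

section Asymptotics

open Set Filter Topology

lemma div_one_add_mul_nonneg {c w : ℝ} (hc : 0 < c) (hw : 0 < w) : 0 ≤ w / (1 + c * w) := by
  positivity

lemma div_one_add_mul_le_self {c w : ℝ} (hc : 0 < c) (hw : 0 < w) : w / (1 + c * w) ≤ w :=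
  div_le_self hw.le (by nlinarith [mul_pos hc hw])

lemma mul_div_one_add_mul_le_one {c w : ℝ} (hc : 0 < c) (hw : 0 < w) :
    c * (w / (1 + c * w)) ≤ 1 := by
  rw [← mul_div_assoc, div_le_one (by positivity)]
  linarith

lemma monotoneOn_div_one_add_mul {c : ℝ} (hc : 0 < c) :
    MonotoneOn (fun w : ℝ => w / (1 + c * w)) (Ioi 0) := by
  intro u hu v hv huv
  have hu : 0 < u := hu
  have hv : 0 < v := hv
  simp only
  rw [div_le_div_iff₀ (by positivity) (by positivity)]
  nlinarith

lemma MonotoneBetweenPowers.pow_mul {k i j : ℕ} {g : ℝ → ℝ} {C D : ℝ}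
    (hmono : MonotoneOn g (Ioi 0)) (h0 : ∀ w, 0 < w → 0 ≤ g w)
    (hC : ∀ w, 0 < w → g w ≤ C * w ^ i) (hD : ∀ w, 0 < w → g w ≤ D * w ^ j) :
    MonotoneBetweenPowers (fun w => w ^ k * g w) (k + i) (k + j) where
  mono := MonotoneOn.mul (fun _ hu _ _ huv => pow_le_pow_left₀ (le_of_lt hu) huv k) hmono
    (fun u hu => pow_nonneg (le_of_lt hu) k) h0
  nonneg := fun w hw => mul_nonneg (pow_nonneg hw.le k) (h0 w hw)
  le_pow_left := ⟨C, fun w hw => by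
    have := mul_le_mul_of_nonneg_left (hC w hw) (pow_nonneg hw.le k)
    rw [pow_add]
    linarith⟩
  le_pow_right := ⟨D, fun w hw => by
    have := mul_le_mul_of_nonneg_left (hD w hw) (pow_nonneg hw.le k)
    rw [pow_add]
    linarith⟩

lemma eulerTerm_eq (k : ℕ) (w : ℝ) :
    eulerTerm k w = (k + 1) * (w ^ k * (w / (1 + 1 * w))) - w ^ k * (w / (1 + 1 * w)) ^ 2 := by
  rw [eulerTerm, one_mul, div_pow]
  ring

lemma monotoneBetweenPowers_pow_mul_div (k : ℕ) :
    MonotoneBetweenPowers (fun w => w ^ k * (w / (1 + 1 * w))) k (k + 1) :=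
  MonotoneBetweenPowers.pow_mul (i := 0) (j := 1) (C := 1) (D := 1)
    (monotoneOn_div_one_add_mul one_pos)
    (fun w hw => div_one_add_mul_nonneg one_pos hw)
    (fun w hw => by simpa using mul_div_one_add_mul_le_one one_pos hw)
    (fun w hw => by simpa using div_one_add_mul_le_self one_pos hw)

lemma monotoneBetweenPowers_pow_mul_div_sq (k : ℕ) :
    MonotoneBetweenPowers (fun w => w ^ k * (w / (1 + 1 * w)) ^ 2) k (k + 1) := by
  have h0 : ∀ w : ℝ, 0 < w → 0 ≤ w / (1 + 1 * w) := fun w hw => div_one_add_mul_nonneg one_pos hw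
  have h1 : ∀ w : ℝ, 0 < w → w / (1 + 1 * w) ≤ 1 := fun w hw => by
    simpa using mul_div_one_add_mul_le_one one_pos hw
  refine MonotoneBetweenPowers.pow_mul (i := 0) (j := 1) (C := 1) (D := 1) ?_
    (fun w _ => sq_nonneg _) (fun w hw => ?_) (fun w hw => ?_)
  · intro u hu v hv huv
    exact pow_le_pow_left₀ (h0 u hu) (monotoneOn_div_one_add_mul one_pos hu hv huv) 2
  · rw [pow_zero, mul_one]
    exact pow_le_one₀ (h0 w hw) (h1 w hw)
  · have h2 := div_one_add_mul_le_self (w := w) one_pos hw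
    rw [pow_one]
    exact ((pow_le_of_le_one (h0 w hw) (h1 w hw) two_ne_zero).trans h2).trans_eq (one_mul w).symm

lemma eulerTerm_pos (k : ℕ) {w : ℝ} (hw : 0 < w) :
    0 < (k + 1) * (w ^ k * (w / (1 + 1 * w))) - w ^ k * (w / (1 + 1 * w)) ^ 2 := by
  have h1 : w / (1 + 1 * w) < 1 := by
    rw [div_lt_one (by positivity)]
    linarith
  have h2 : 0 < w / (1 + 1 * w) := by positivity
  have h3 : 0 < w ^ k := by positivity
  have h4 : (0 : ℝ) ≤ k := Nat.cast_nonneg k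
  have : 0 < w ^ k * (w / (1 + 1 * w)) * (k + (1 - w / (1 + 1 * w))) :=
    mul_pos (mul_pos h3 h2) (by linarith)
  linarith

lemma summable_eulerTerm {k : ℕ} {a : ℕ → ℝ} (ha0 : ∀ n, 0 < a n)
    (hsum : Summable fun n => a n ^ (k + 1)) {x : ℝ} (hx : 0 < x) :
    Summable fun n => eulerTerm k (a n * x) := by
  refine Summable.of_nonneg_of_le (f := fun n => (k + 1) * (a n ^ (k + 1) * x ^ (k + 1)))
    (fun n => ?_) (fun n => ?_) ((hsum.mul_right _).mul_left _)
  · rw [eulerTerm_eq k]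
    exact (eulerTerm_pos k (mul_pos (ha0 n) hx)).le
  · have hw := mul_pos (ha0 n) hx
    have h1 : (a n * x) ^ (k + 1) / (1 + a n * x) ≤ (a n * x) ^ (k + 1) :=
      div_le_self (by positivity) (by linarith)
    have h2 : 0 ≤ (a n * x) ^ (k + 2) / (1 + a n * x) ^ 2 := by positivity
    have h3 := mul_le_mul_of_nonneg_left h1 (show (0 : ℝ) ≤ k + 1 by positivity)
    rw [eulerTerm, ← mul_pow]
    linarith

/-- The sum of `eulerTerm k (x / n ^ s)` over `n ≥ 1`. -/
noncomputable def eulerSum (k : ℕ) (s x : ℝ) : ℝ :=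
  ∑' n : ℕ, eulerTerm k ((((n : ℝ) + 1) ^ s)⁻¹ * x)

/-- If `1 / s` lies strictly between `k` and `k + 1`, then `eulerSum k s` is asymptotic to a
constant multiple of `x ^ (1 / s)`. -/
lemma tendsto_eulerSum_div {k : ℕ} {s : ℝ} (hs : 0 < s) (hk : k * s < 1) (hk' : 1 < (k + 1) * s)
    {y : ℝ} (hy : 0 < y) :
    Tendsto (fun x => eulerSum k s (x * y) / eulerSum k s x) atTop (𝓝 (y ^ (1 / s))) := by
  obtain ⟨I, hI, hlim⟩ := exists_pos_tendsto_tsum_sub ((k : ℝ) + 1)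
    (monotoneBetweenPowers_pow_mul_div k) (monotoneBetweenPowers_pow_mul_div_sq k) hs hk
    (by exact_mod_cast hk') (fun w hw => eulerTerm_pos k hw)
  have hlim' : Tendsto (fun x => x ^ (-(1 / s)) * eulerSum k s x) atTop (𝓝 I) := by
    refine hlim.congr' ?_
    filter_upwards [eventually_gt_atTop 0] with x hx
    rw [eulerSum]
    congr 1
    exact tsum_congr fun n => (eulerTerm_eq k _).symm
  have hq := ((hlim'.comp (tendsto_id.atTop_mul_const hy)).div hlim' hI.ne').const_mul (y ^ (1 / s))
  rw [div_self hI.ne', mul_one] at hq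
  refine hq.congr' ?_
  filter_upwards [eventually_gt_atTop 0] with x hx
  simp only [Pi.div_apply, Function.comp_apply, id]
  have h1 : 0 < x ^ (1 / s) := Real.rpow_pos_of_pos hx _
  have h2 : 0 < y ^ (1 / s) := Real.rpow_pos_of_pos hy _
  rw [Real.rpow_neg (by positivity), Real.rpow_neg hx.le, Real.mul_rpow hx.le hy.le]
  by_cases h3 : eulerSum k s x = 0
  · simp [h3]
  · field_simp

lemma summable_inv_rpow_pow {k : ℕ} {s : ℝ} (hk' : 1 < (k + 1) * s) :
    Summable fun n : ℕ => ((((n : ℝ) + 1) ^ s)⁻¹) ^ (k + 1) := by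
  have h1 := (summable_nat_add_iff 1).2 (Real.summable_nat_rpow_inv.2 hk')
  refine h1.congr fun n => ?_
  rw [inv_pow, ← Real.rpow_mul_natCast (by positivity)]
  push_cast
  rw [mul_comm s]

/-- The increment under `w ↦ w * y` is written as a difference of two increasing functions, each of
which decays fast enough at both ends for its Riemann sums to converge. -/
lemma eulerTerm_mul_div_pow_sub (l : ℕ) {y w : ℝ} (hy : 0 < y) (hw : 0 < w) :
    eulerTerm (l + 1) (w * y) / y ^ (l + 1) - eulerTerm (l + 1) w =
      (y - 1) * (l + 2) * (w ^ l * (w / (1 + 1 * w) * (w / (1 + y * w)))) -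
        w ^ l * ((y - 1) * (w / (1 + 1 * w) * (w / (1 + y * w))) *
          (y * (w / (1 + y * w)) + w / (1 + 1 * w))) := by
  have h1 : 1 + w ≠ 0 := by positivity
  have h2 : 1 + y * w ≠ 0 := by positivity
  rw [eulerTerm, eulerTerm, one_mul, mul_pow, mul_pow, mul_comm w y]
  push_cast
  field_simp
  ring

/-- If `1 / s` is the integer `l + 1`, then `eulerSum (l + 1) s x / x ^ (l + 1)` differs from a
nonzero multiple of the logarithm by a term that converges at infinity; only the increments of
this function are used. -/
lemma exists_tendsto_eulerSum_sub {l : ℕ} {s : ℝ} (hs : (l + 1) * s = 1) {y : ℝ} (hy : 1 < y) :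
    ∃ L : ℝ, 0 < L ∧
      Tendsto (fun x => eulerSum (l + 1) s (x * y) / (x * y) ^ (l + 1) -
        eulerSum (l + 1) s x / x ^ (l + 1)) atTop (𝓝 L) := by
  have hy0 : 0 < y := by linarith
  have hs0 : 0 < s := by
    by_contra! h
    nlinarith [(Nat.cast_nonneg l : (0 : ℝ) ≤ l)]
  have hinv : 1 / s = ((l + 1 : ℕ) : ℝ) := by
    rw [div_eq_iff hs0.ne']; push_cast; exact hs.symm
  have hp0 : ∀ w : ℝ, 0 < w → 0 ≤ w / (1 + 1 * w) := fun w hw => div_one_add_mul_nonneg one_pos hw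
  have hp1 : ∀ w : ℝ, 0 < w → w / (1 + 1 * w) ≤ 1 := fun w hw => by
    simpa using mul_div_one_add_mul_le_one one_pos hw
  have hpw : ∀ w : ℝ, 0 < w → w / (1 + 1 * w) ≤ w := fun w hw => div_one_add_mul_le_self one_pos hw
  have hr0 : ∀ w : ℝ, 0 < w → 0 ≤ w / (1 + y * w) := fun w hw => div_one_add_mul_nonneg hy0 hw
  have hr1 : ∀ w : ℝ, 0 < w → w / (1 + y * w) ≤ 1 := fun w hw => by
    have h1 := mul_div_one_add_mul_le_one hy0 hw
    nlinarith [hr0 w hw]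
  have hrw : ∀ w : ℝ, 0 < w → w / (1 + y * w) ≤ w := fun w hw => div_one_add_mul_le_self hy0 hw
  have hmono := (monotoneOn_div_one_add_mul one_pos).mul (monotoneOn_div_one_add_mul hy0) hp0 hr0
  have hg0 : ∀ w : ℝ, 0 < w → 0 ≤ w / (1 + 1 * w) * (w / (1 + y * w)) := fun w hw =>
    mul_nonneg (hp0 w hw) (hr0 w hw)
  have hg1 : ∀ w : ℝ, 0 < w → w / (1 + 1 * w) * (w / (1 + y * w)) ≤ 1 := fun w hw =>
    mul_le_one₀ (hp1 w hw) (hr0 w hw) (hr1 w hw)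
  have hgw : ∀ w : ℝ, 0 < w → w / (1 + 1 * w) * (w / (1 + y * w)) ≤ w ^ 2 := fun w hw => by
    rw [sq]
    exact mul_le_mul (hpw w hw) (hrw w hw) (hr0 w hw) hw.le
  have hf0 : ∀ w : ℝ, 0 < w → 0 ≤ y * (w / (1 + y * w)) + w / (1 + 1 * w) := fun w hw =>
    add_nonneg (mul_nonneg hy0.le (hr0 w hw)) (hp0 w hw)
  have hf2 : ∀ w : ℝ, 0 < w → y * (w / (1 + y * w)) + w / (1 + 1 * w) ≤ 2 := fun w hw => by
    linarith [mul_div_one_add_mul_le_one hy0 hw, hp1 w hw]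
  have hE₁ := MonotoneBetweenPowers.pow_mul (k := l) (i := 0) (j := 2) (C := 1) (D := 1)
    (g := fun w => w / (1 + 1 * w) * (w / (1 + y * w))) hmono hg0
    (fun w hw => by simpa using hg1 w hw) (fun w hw => by simpa using hgw w hw)
  have hE₂ := MonotoneBetweenPowers.pow_mul (k := l) (i := 0) (j := 2) (C := (y - 1) * 2)
    (D := (y - 1) * 2)
    (g := fun w => (y - 1) * (w / (1 + 1 * w) * (w / (1 + y * w))) *
          (y * (w / (1 + y * w)) + w / (1 + 1 * w)))
    (by
      refine MonotoneOn.mul ?_ ?_ ?_ hf0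
      · exact fun u hu v hv huv => mul_le_mul_of_nonneg_left (hmono hu hv huv) (by linarith)
      · exact fun u hu v hv huv => add_le_add
          (mul_le_mul_of_nonneg_left (monotoneOn_div_one_add_mul hy0 hu hv huv) hy0.le)
          (monotoneOn_div_one_add_mul one_pos hu hv huv)
      · exact fun u hu => mul_nonneg (by linarith) (hg0 u hu))
    (fun w hw => mul_nonneg (mul_nonneg (by linarith) (hg0 w hw)) (hf0 w hw))
    (fun w hw => by
      have := mul_le_mul (mul_le_mul_of_nonneg_left (hg1 w hw) (show 0 ≤ y - 1 by linarith))
        (hf2 w hw) (hf0 w hw) (by linarith)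
      linarith)
    (fun w hw => by
      have := mul_le_mul (mul_le_mul_of_nonneg_left (hgw w hw) (show 0 ≤ y - 1 by linarith))
        (hf2 w hw) (hf0 w hw) (mul_nonneg (by linarith) (sq_nonneg w))
      linarith)
  have hpos : ∀ w : ℝ, 0 < w →
      0 < (y - 1) * (l + 2) * (w ^ l * (w / (1 + 1 * w) * (w / (1 + y * w)))) -
        w ^ l * ((y - 1) * (w / (1 + 1 * w) * (w / (1 + y * w))) *
          (y * (w / (1 + y * w)) + w / (1 + 1 * w))) := by
    intro w hw
    have h1 : w / (1 + 1 * w) < 1 := by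
      rw [div_lt_one (by positivity)]
      linarith
    have h2 : y * (w / (1 + y * w)) + w / (1 + 1 * w) < l + 2 := by
      linarith [mul_div_one_add_mul_le_one hy0 hw, (Nat.cast_nonneg l : (0 : ℝ) ≤ l)]
    have h3 : 0 < (y - 1) * (w ^ l * (w / (1 + 1 * w) * (w / (1 + y * w)))) :=
      mul_pos (by linarith) (by positivity)
    nlinarith [mul_pos h3 (sub_pos.2 h2)]
  obtain ⟨L, hL, hlim⟩ := exists_pos_tendsto_tsum_sub ((y - 1) * ((l : ℝ) + 2)) hE₁ hE₂ hs0
    (by push_cast; nlinarith) (by push_cast; nlinarith) hpos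
  refine ⟨L, hL, hlim.congr' ?_⟩
  filter_upwards [eventually_gt_atTop 0] with x hx
  have hsum := summable_inv_rpow_pow (k := l + 1) (s := s) (by push_cast; nlinarith)
  have ha0 : ∀ n : ℕ, 0 < (((n : ℝ) + 1) ^ s)⁻¹ := fun n => by positivity
  have hs₁ := summable_eulerTerm ha0 hsum (mul_pos hx hy0)
  have hs₂ := summable_eulerTerm ha0 hsum hx
  have hx0 : x ^ (l + 1) ≠ 0 := by positivity
  rw [Real.rpow_neg hx.le, hinv, Real.rpow_natCast, eulerSum, eulerSum, mul_pow, mul_comm (x ^ _),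
    ← div_div, ← sub_div, ← tsum_div_const, ← (hs₁.div_const _).tsum_sub hs₂, inv_mul_eq_div]
  congr 1
  refine tsum_congr fun n => ?_
  rw [← eulerTerm_mul_div_pow_sub l hy0 (mul_pos (ha0 n) hx), mul_assoc _ x y]

/-! ### The two products of the statement -/

lemma mul_derivXLogDeriv_eulerF {α : ℝ} (hα : 1 < α) {x : ℝ} (hx : 0 < x) :
    0 < eulerF α x ∧ x * derivXLogDeriv (eulerF α) x = halfThetaSum α⁻¹ x := by
  have hα0 : 0 < α := by linarith
  have h := mul_derivXLogDeriv_eq (k := 0) (a := fun n : ℕ => (α ^ (n + 1))⁻¹) (G := eulerF α)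
    (fun n => by positivity) (fun n => inv_le_one_of_one_le₀ (one_le_pow₀ hα.le))
    (by
      simp_rw [zero_add, pow_one, ← inv_pow]
      exact (summable_nat_add_iff 1).2
        (summable_geometric_of_lt_one (by positivity) (inv_lt_one_of_one_lt₀ hα)))
    (fun y hy => by
      rw [eulerF]
      refine tprod_congr fun n => ?_
      rw [logElementaryFactor, Finset.Icc_eq_empty (by norm_num), Finset.sum_empty, add_zero,
        Real.exp_log (by positivity)]) hx
  refine ⟨h.1, h.2.trans ?_⟩
  rw [pow_zero, one_mul, halfThetaSum]
  refine tsum_congr fun n => ?_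
  have hw : 1 + α⁻¹ ^ (n + 1) * x ≠ 0 := by positivity
  rw [eulerTerm, ← inv_pow]
  simp only [Nat.cast_zero, zero_add, pow_one, one_mul]
  field_simp
  ring

lemma mul_derivXLogDeriv_weierstrassW {s : ℝ} (hs : 0 < s) {x : ℝ} (hx : 0 < x) :
    x * derivXLogDeriv (weierstrassW s) x = (-1) ^ ⌊1 / s⌋₊ * eulerSum ⌊1 / s⌋₊ s x := by
  have hk : 1 < ((⌊1 / s⌋₊ : ℝ) + 1) * s := (div_lt_iff₀ hs).1 (Nat.lt_floor_add_one _)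
  refine (mul_derivXLogDeriv_eq (k := ⌊1 / s⌋₊) (a := fun n : ℕ => (((n : ℝ) + 1) ^ s)⁻¹)
    (G := weierstrassW s) (fun n => by positivity)
    (fun n => inv_le_one_of_one_le₀ (Real.one_le_rpow (by simp) hs.le))
    (summable_inv_rpow_pow hk) (fun y hy => ?_) hx).2
  rw [weierstrassW]
  refine tprod_congr fun n => ?_
  rw [logElementaryFactor, Real.exp_add, Real.exp_log (by positivity), inv_mul_eq_div]
  congr 2
  refine Finset.sum_congr rfl fun j _ => ?_
  rw [div_pow, ← Real.rpow_mul_natCast (by positivity), ← mul_div_assoc, div_div, mul_comm (j : ℝ)]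

end Asymptotics

/-! ### Defining the integers -/

section DefiningIntegers

open Set Filter Topology

variable {ι : Type} {f : ι → (ℝ →. ℝ)}

/-- A partial function of the family gives a definable total function by restriction to `(0, ∞)`
and extension by zero. -/
lemma definableFun_of_graph (i : ι) {h : ℝ → ℝ} (hf : ∀ x, 0 < x → ∀ y, y ∈ f i x ↔ y = h x) :
    DefinableFun f fun v => if 0 < v 0 then h (v 0) else 0 := by
  have hpos : DefinablePred f fun v => 0 < v 1 := .lt (.const 0) (.var 1)
  refine ((hpos.and ((DefinablePred.mem_graph i).reindex (consIdx 1 fun _ => 0))).or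
    (hpos.not.and (.eq (.var 0) (.const 0)))).congr fun v => ?_
  by_cases h0 : 0 < v 1
  · have := hf (v 1) h0 (v 0)
    simp only [zero_add, h0, if_true, true_and, not_true_eq_false, false_and, or_false]
    exact this.symm
  · simp [h0]

/-- A definable function equal to `halfThetaSum b` on `(0, ∞)` makes some group `γ ^ ℤ` definable:
it is the group of asymptotic periods. -/
lemma exists_definable_zpowers {F : ℝ → ℝ} (hF : DefinableFun f fun v => F (v 0)) {b : ℝ}
    (hb0 : 0 < b) (hb1 : b < 1) (hFb : ∀ x, 0 < x → F x = halfThetaSum b x) :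
    ∃ γ : ℝ, 1 < γ ∧ DefinablePred f fun v => ∃ n : ℤ, v 0 = γ ^ n := by
  obtain ⟨γ, hγ, hper⟩ := exists_generator_periods hb0 hb1
  refine ⟨γ, hγ, ?_⟩
  have hd : DefinablePred f fun v => 0 < v 0 ∧
      Tendsto (fun x => F (x * v 0) - F x) atTop (𝓝 0) :=
    .and (.lt (.const 0) (.var 0)) (.tendsto_atTop (h := fun v x => F (x * v 0) - F x)
      ((hF.comp ((DefinableFun.var 0).mul (.var 1))).sub (hF.comp (.var 0))) (.const 0))
  refine hd.congr fun v => ?_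
  have hiff : 0 < v 0 → (Tendsto (fun x => F (x * v 0) - F x) atTop (𝓝 0) ↔
      ∃ n : ℤ, v 0 = γ ^ n) := by
    intro h0
    rw [← hper _ h0]
    refine tendsto_congr' ?_
    filter_upwards [eventually_gt_atTop 0] with x hx
    rw [hFb x hx, hFb _ (mul_pos hx h0)]
  constructor
  · rintro ⟨n, hn⟩
    have h0 : 0 < v 0 := by rw [hn]; exact zpow_pos (by linarith) n
    exact ⟨h0, (hiff h0).2 ⟨n, hn⟩⟩
  · rintro ⟨h0, h⟩
    exact (hiff h0).1 h

/-- If `K` has an asymptotic increment `L` along `x ↦ x * γ`, it has the asymptotic increment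
`n * L` along `x ↦ x * γ ^ n`. -/
lemma tendsto_sub_zpow {K : ℝ → ℝ} {γ L : ℝ} (hγ : 0 < γ)
    (h : Tendsto (fun x => K (x * γ) - K x) atTop (𝓝 L)) (n : ℤ) :
    Tendsto (fun x => K (x * γ ^ n) - K x) atTop (𝓝 (n * L)) := by
  have hcomp : ∀ i : ℤ, Tendsto (fun x => K (x * γ ^ i * γ) - K (x * γ ^ i)) atTop (𝓝 L) :=
    fun i => h.comp (tendsto_id.atTop_mul_const (zpow_pos hγ i))
  induction n using Int.induction_on with
  | zero => simp
  | succ i ih =>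
    have := ih.add (hcomp i)
    push_cast
    rw [add_mul, one_mul]
    refine this.congr fun x => ?_
    rw [zpow_add_one₀ hγ.ne', ← mul_assoc]
    ring
  | pred i ih =>
    have := ih.sub (hcomp (-i - 1))
    push_cast at this ⊢
    rw [sub_mul, one_mul]
    refine this.congr fun x => ?_
    have h1 : x * γ ^ (-(i : ℤ) - 1) * γ = x * γ ^ (-(i : ℤ)) := by
      rw [mul_assoc, ← zpow_add_one₀ hγ.ne', sub_add_cancel]
    rw [h1]
    ring

/-- The integers are the image of `γ ^ ℤ` under a logarithm definable by asymptotic increments. -/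
lemma definable_int_of_log {K : ℝ → ℝ} (hK : DefinableFun f fun v => K (v 0)) {γ L : ℝ}
    (hγ : 0 < γ) (hpow : DefinablePred f fun v => ∃ n : ℤ, v 0 = γ ^ n) (hL : L ≠ 0)
    (h : Tendsto (fun x => K (x * γ) - K x) atTop (𝓝 L)) :
    DefinablePred f fun v => v 0 ∈ range ((↑) : ℤ → ℝ) := by
  have hd : DefinablePred f fun v => ∃ y : ℝ, (∃ n : ℤ, y = γ ^ n) ∧
      Tendsto (fun x => K (x * y) - K x) atTop (𝓝 (v 0 * L)) := by
    refine .ex (.and hpow (.tendsto_atTop (h := fun v x => K (x * v 0) - K x) ?_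
      ((DefinableFun.var 1).mul (.const L))))
    exact (hK.comp ((DefinableFun.var 0).mul (.var 1))).sub (hK.comp (.var 0))
  refine hd.congr fun v => ?_
  constructor
  · rintro ⟨n, hn⟩
    exact ⟨γ ^ n, ⟨n, rfl⟩, hn ▸ tendsto_sub_zpow hγ h n⟩
  · rintro ⟨_, ⟨n, rfl⟩, hy⟩
    exact ⟨n, mul_right_cancel₀ hL (tendsto_nhds_unique (tendsto_sub_zpow hγ h n) hy)⟩

/-- A real is an integer if it is approximated by differences of arbitrarily large members of a
sequence asymptotic to `n + 2`. -/
lemma mem_range_intCast_iff_of_sequence {t : ℕ → ℝ}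
    (ht : ∀ n : ℕ, (n : ℝ) + 2 ≤ t n ∧ t n ≤ n + 2 + 1 / (n + 1)) (y : ℝ) :
    y ∈ range ((↑) : ℤ → ℝ) ↔ ∀ ε : ℝ, 0 < ε → ∀ M : ℝ, ∃ a, (∃ n, a = t n) ∧
      ∃ b, (∃ n, b = t n) ∧ M < a ∧ M < b ∧ b - a < y + ε ∧ y < b - a + ε := by
  have hinv : ∀ ε : ℝ, 0 < ε → ∃ N : ℕ, ∀ n ≥ N, 1 / ((n : ℝ) + 1) < ε := by
    intro ε hε
    obtain ⟨N, hN⟩ := exists_nat_one_div_lt hε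
    refine ⟨N, fun n hn => lt_of_le_of_lt ?_ hN⟩
    have : (N : ℝ) ≤ n := by exact_mod_cast hn
    exact one_div_le_one_div_of_le (by positivity) (by linarith)
  constructor
  · rintro ⟨k, rfl⟩ ε hε M
    obtain ⟨N, hN⟩ := hinv ε hε
    obtain ⟨P, hP⟩ := exists_nat_gt M
    obtain ⟨i, j, hi, hj, hij⟩ : ∃ i j : ℕ, max N P ≤ i ∧ max N P ≤ j ∧ (j : ℤ) - i = k :=
      ⟨max N P + (-k).toNat, max N P + k.toNat, by omega, by omega, by omega⟩
    have hij' : (j : ℝ) - i = k := by exact_mod_cast hij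
    have hi1 : (P : ℝ) ≤ i := by exact_mod_cast (le_max_right N P).trans hi
    have hj1 : (P : ℝ) ≤ j := by exact_mod_cast (le_max_right N P).trans hj
    have hi2 := hN i ((le_max_left N P).trans hi)
    have hj2 := hN j ((le_max_left N P).trans hj)
    have hti := ht i
    have htj := ht j
    exact ⟨t i, ⟨i, rfl⟩, t j, ⟨j, rfl⟩, by linarith, by linarith, by linarith, by linarith⟩
  · intro h
    have hclosed : IsClosed (range ((↑) : ℤ → ℝ)) := Int.isClosedEmbedding_coe_real.isClosed_range
    rw [← hclosed.closure_eq, Metric.mem_closure_iff]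
    intro ε hε
    obtain ⟨N, hN⟩ := hinv (ε / 2) (by linarith)
    obtain ⟨a, ⟨i, rfl⟩, b, ⟨j, rfl⟩, ha, hb, h1, h2⟩ := h (ε / 2) (by linarith) (N + 3)
    have hti := ht i
    have htj := ht j
    have hle : ∀ n : ℕ, 1 / ((n : ℝ) + 1) ≤ 1 := fun n => by
      rw [div_le_one (by positivity)]
      linarith [(Nat.cast_nonneg n : (0 : ℝ) ≤ n)]
    have hiN : N ≤ i := by
      have h3 : (N : ℝ) ≤ i := by linarith [hle i]
      exact_mod_cast h3
    have hjN : N ≤ j := by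
      have h3 : (N : ℝ) ≤ j := by linarith [hle j]
      exact_mod_cast h3
    have hi2 := hN i hiN
    have hj2 := hN j hjN
    refine ⟨((j - i : ℤ) : ℝ), ⟨_, rfl⟩, ?_⟩
    rw [Real.dist_eq, abs_lt]
    push_cast
    constructor <;> linarith

/-- If `γ ^ ℤ` and the power function with an irrational exponent are definable, then so is `ℤ`.
The representatives `φ j` of `γ ^ (j * r)` in `[1, γ)` are dense, and a suitable parameter `c`
selects from them, by the quality of approximation, a sequence of reals asymptotic to `n + 2`. -/
lemma definable_int_of_irrational_power {γ r : ℝ} (hγ : 1 < γ) (hr : Irrational r)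
    (hpow : DefinablePred f fun v => ∃ n : ℤ, v 0 = γ ^ n)
    {R : ℝ → ℝ → Prop} (hR : DefinablePred f fun v => R (v 0) (v 1))
    (hRr : ∀ y z, 0 < y → (R y z ↔ z = y ^ r)) :
    DefinablePred f fun v => v 0 ∈ range ((↑) : ℤ → ℝ) := by
  have hγ0 : 0 < γ := by linarith
  obtain ⟨c, N, J, hJ, hJN, hval⟩ := exists_coding_real
    (φ := fun j : ℕ => γ ^ Int.fract ((j : ℝ) * r)) hγ (hr.rpow_fract_dense hγ)
    (hr.rpow_fract_separated hγ)
  have hT : DefinablePred f fun v => ∃ d : ℝ, ((∃ n : ℤ, d = γ ^ n) ∧ γ ^ N ≤ d) ∧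
      ∃ g : ℝ, (∃ n : ℤ, g = γ ^ n) ∧ ∃ w : ℝ, R d w ∧ (1 ≤ w * g ∧ w * g < γ) ∧
        (0 < c - w * g ∧ d * (c - w * g) < 1) ∧ v 0 = (d * (c - w * g))⁻¹ := by
    have hw : DefinableFun f fun v => v 0 * v 1 := (DefinableFun.var 0).mul (.var 1)
    have hcw : DefinableFun f fun v => c - v 0 * v 1 := (DefinableFun.const c).sub hw
    have hdw : DefinableFun f fun v => v 2 * (c - v 0 * v 1) := (DefinableFun.var 2).mul hcw
    refine .ex (.and (.and hpow (.le (.const _) (.var 0))) (.ex (.and hpow (.ex (.and ?_ (.and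
      (.and (.le (.const 1) hw) (.lt hw (.const γ))) (.and
      (.and (.lt (.const 0) hcw) (.lt hdw (.const 1))) (.eq (.var 3) hdw.inv))))))))
    exact hR.reindex (consIdx 2 fun _ => 0)
  have hTiff : ∀ x : ℝ, (∃ d : ℝ, ((∃ n : ℤ, d = γ ^ n) ∧ γ ^ N ≤ d) ∧
      ∃ g : ℝ, (∃ n : ℤ, g = γ ^ n) ∧ ∃ w : ℝ, R d w ∧ (1 ≤ w * g ∧ w * g < γ) ∧
        (0 < c - w * g ∧ d * (c - w * g) < 1) ∧ x = (d * (c - w * g))⁻¹) ↔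
      ∃ n, x = (γ ^ J n * (c - γ ^ Int.fract ((J n : ℝ) * r)))⁻¹ := by
    intro x
    constructor
    · rintro ⟨_, ⟨⟨i, rfl⟩, hN⟩, _, ⟨m, rfl⟩, w, hw, hw1, hw2, rfl⟩
      rw [← zpow_natCast, zpow_le_zpow_iff_right₀ hγ] at hN
      obtain ⟨j, rfl⟩ := Int.eq_ofNat_of_zero_le (show 0 ≤ i by omega)
      rw [zpow_natCast] at hw hw2 ⊢
      rw [hRr _ _ (by positivity)] at hw
      subst hw
      have hfr := (exists_zpow_mul_eq_iff hγ r _ j).1 ⟨m, rfl, hw1⟩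
      rw [hfr] at hw2 ⊢
      obtain ⟨n, rfl⟩ := (hJ j (by omega)).1 hw2
      exact ⟨n, rfl⟩
    · rintro ⟨n, rfl⟩
      obtain ⟨m, hm, hm1⟩ := (exists_zpow_mul_eq_iff hγ r _ (J n)).2 rfl
      refine ⟨γ ^ J n, ⟨⟨J n, (zpow_natCast _ _).symm⟩, pow_le_pow_right₀ hγ.le (hJN n)⟩, γ ^ m,
        ⟨m, rfl⟩, (γ ^ J n) ^ r, (hRr _ _ (by positivity)).2 rfl, ?_⟩
      rw [← hm]
      exact ⟨hm1, (hJ (J n) (hJN n)).2 ⟨n, rfl⟩, rfl⟩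
  have hT' : DefinablePred f fun v =>
      ∃ n, v 0 = (γ ^ J n * (c - γ ^ Int.fract ((J n : ℝ) * r)))⁻¹ :=
    hT.congr fun v => (hTiff (v 0)).symm
  refine DefinablePred.congr ?_ fun v => mem_range_intCast_iff_of_sequence hval (v 0)
  refine .all (.imp (.lt (.const 0) (.var 0)) (.all (.ex (.and hT' (.ex (.and hT' ?_))))))
  have hba : DefinableFun f fun v => v 0 - v 1 := (DefinableFun.var 0).sub (.var 1)
  exact .and (.lt (.var 2) (.var 1)) (.and (.lt (.var 2) (.var 0)) (.and
    (.lt hba ((DefinableFun.var 4).add (.var 3))) (.lt (.var 4) (hba.add (.var 3)))))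

/-- Only the values on `(0, ∞)` of the two functions matter for defining the integers. -/
lemma rbarDefines_int {f : Fin 2 → (ℝ →. ℝ)} {α β : ℝ} (hα : 1 < α) (hβpos : 0 < β)
    (hβ : (∃ m : ℕ, 1 / β = (m : ℝ)) ∨ Irrational β)
    (hf₀ : ∀ x, 0 < x → ∀ y, y ∈ f 0 x ↔ y = derivXLogDeriv (eulerF α) x)
    (hf₁ : ∀ x, 0 < x → ∀ y, y ∈ f 1 x ↔ y = derivXLogDeriv (weierstrassW β) x) :
    RbarDefines f (range ((↑) : ℤ → ℝ)) := by
  refine DefinablePred.rbarDefines ?_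
  obtain ⟨γ, hγ, hpow⟩ := exists_definable_zpowers (b := α⁻¹)
    (F := fun x => x * if 0 < x then derivXLogDeriv (eulerF α) x else 0)
    ((DefinableFun.var 0).mul (definableFun_of_graph 0 hf₀))
    (by positivity) (inv_lt_one_of_one_lt₀ hα)
    (fun x hx => by rw [if_pos hx, (mul_derivXLogDeriv_eulerF hα hx).2])
  obtain ⟨k, hk⟩ : ∃ k : ℕ, k = ⌊1 / β⌋₊ := ⟨_, rfl⟩
  obtain ⟨S, hSdef, hS⟩ : ∃ S : ℝ → ℝ, DefinableFun f (fun v => S (v 0)) ∧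
      ∀ x, 0 < x → S x = eulerSum k β x := by
    refine ⟨fun x => (-1) ^ k * (x * if 0 < x then derivXLogDeriv (weierstrassW β) x else 0),
      (DefinableFun.const _).mul ((DefinableFun.var 0).mul (definableFun_of_graph 1 hf₁)),
      fun x hx => ?_⟩
    simp only
    rw [if_pos hx, mul_derivXLogDeriv_weierstrassW hβpos hx, ← hk, ← mul_assoc, ← mul_pow]
    simp
  have hβ0 : 0 < 1 / β := by positivity
  have hk' : 1 < ((k : ℝ) + 1) * β := by
    rw [hk]
    exact (div_lt_iff₀ hβpos).1 (Nat.lt_floor_add_one _)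
  rcases hβ with ⟨m, hm⟩ | hirr
  · obtain ⟨l, rfl⟩ : ∃ l, m = l + 1 :=
      Nat.exists_eq_succ_of_ne_zero (by rintro rfl; rw [Nat.cast_zero] at hm; linarith)
    have hkl : k = l + 1 := by rw [hk, hm, Nat.floor_natCast]
    rw [hkl] at hS
    obtain ⟨L, hL, hlim⟩ := exists_tendsto_eulerSum_sub (l := l) (s := β)
      (by rw [div_eq_iff hβpos.ne'] at hm; push_cast at hm; exact hm.symm) hγ
    refine definable_int_of_log (K := fun x => S x / x ^ (l + 1))
      (hSdef.div ((DefinableFun.var 0).pow (l + 1))) (by linarith) hpow hL.ne' (hlim.congr' ?_)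
    filter_upwards [eventually_gt_atTop 0] with x hx
    rw [hS x hx, hS _ (mul_pos hx (by linarith))]
  · have hr : Irrational (1 / β) := by
      rw [one_div]
      exact hirr.inv
    have hkβ : k * β < 1 := by
      rw [← lt_div_iff₀ hβpos]
      refine lt_of_le_of_ne (hk ▸ Nat.floor_le hβ0.le) (hr.ne_nat k).symm
    refine definable_int_of_irrational_power hγ hr hpow
      (R := fun y z => Tendsto (fun x => S (x * y) / S x) atTop (𝓝 z))
      (.tendsto_atTop (h := fun v x => S (x * v 0) / S x)
        ((hSdef.comp ((DefinableFun.var 0).mul (.var 1))).div (hSdef.comp (.var 0))) (.var 1))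
      fun y z hy => ?_
    have hlim : Tendsto (fun x => S (x * y) / S x) atTop (𝓝 (y ^ (1 / β))) := by
      refine (tendsto_eulerSum_div hβpos hkβ hk' hy).congr' ?_
      filter_upwards [eventually_gt_atTop 0] with x hx
      rw [hS x hx, hS _ (mul_pos hx hy)]
    exact ⟨fun h => tendsto_nhds_unique h hlim, fun h => h ▸ hlim⟩

end DefiningIntegers

theorem mainTheorem10 (α β : ℝ) (hα : 1 < α) (hβpos : 0 < β)
    (hβ : (∃ m : ℕ, 1 / β = (m : ℝ)) ∨ Irrational β) :
    RbarDefines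
        ![PFun.res (derivXLogDeriv (eulerF α)) {x : ℝ | eulerF α x ≠ 0},
          PFun.res (derivXLogDeriv (weierstrassW β)) (Set.Ioi 0)]
        (Set.range ((↑) : ℤ → ℝ)) ∧
      RbarDefines
        ![PFun.res (derivXLogDeriv (eulerF α)) (Set.Ioi 0),
          PFun.res (derivXLogDeriv (weierstrassW β)) (Set.Ioi 0)]
        (Set.range ((↑) : ℤ → ℝ)) := by
  have hres : ∀ (h : ℝ → ℝ) (s : Set ℝ) (x y : ℝ), x ∈ s → (y ∈ PFun.res h s x ↔ y = h x) := by
    intro h s x y hx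
    rw [PFun.mem_res]
    exact ⟨fun hy => hy.2.symm, fun hy => ⟨hx, hy.symm⟩⟩
  refine ⟨rbarDefines_int hα hβpos hβ (fun x hx y => ?_) fun x hx y => ?_,
    rbarDefines_int hα hβpos hβ (fun x hx y => ?_) fun x hx y => ?_⟩
  · exact hres _ _ x y (mul_derivXLogDeriv_eulerF hα hx).1.ne'
  · exact hres _ _ x y hx
  · exact hres _ _ x y hx
  · exact hres _ _ x y hx
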